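/- **Setting.** Let $\mathcal S,\mathcal W$ be measurable spaces (states, task contexts), $\mathcal A$ a finite nonempty action set, $H,K,d'\ge 1$ integers and $T=KH$. A contextual MDP has transition kernels $\mathbb P_h(\cdot\mid s,a)$ and known rewards $r_h(s,a,w)\in[0,1]$, $h\in[H]$. For a policy $\pi=(\pi_h)_{h\in[H]}$, $\pi_h:\mathcal S\times\mathcal W\to\mathcal A$, let $V_h^\pi(s,w)=\mathbb E\big[\sum_{h'=h}^H r_{h'}(s_{h'},\pi_{h'}(s_{h'},w),w)\mid s_h=s\big]$, and let $V_h^*(s,w)=\sup_\pi V_h^\pi(s,w)$. At the start of each episode $k\in[K]$ a context $w^k$ and an initial state $s_1^k$ are revealed; they may be chosen adversarially (possibly at random) on the basis of everything that happened before. The agent then fixes a policy $\pi^k$, plays $a_h^k=\pi_h^k(s_h^k,w^k)$, and, given the past, $s_{h+1}^k\sim\mathbb P_h(\cdot\mid s_h^k,a_h^k)$. The regret is $R_K=\sum_{k=1}^K\big(V_1^*(s_1^k,w^k)-V_1^{\pi^k}(s_1^k,w^k)\big)$. Write $\mathbb P_h[f](s,a)=\int f(s')\,\mathbb P_h(ds'\mid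 s,a)$, $\|x\|_B=\sqrt{x^\top Bx}$, $\{x\}^+=\max\{x,0\}$. **Assumptions.** A measurable feature map $\psi:\mathcal S\times\mathcal A\times\mathcal W\to\mathbb R^{d'}$ is given. 1. (Completeness.) For every $\nu\in\mathbb R^{d'}$, $b\in\mathbb R$, every symmetric positive definite $\Lambda\in\mathbb R^{d'\times d'}$ and every $h\in[H]$, with $$f(s,w)=\min\Big\{\max_{a\in\mathcal A}\big\{\langle\nu,\psi(s,a,w)\rangle+b\|\psi(s,a,w)\|_{\Lambda^{-1}}\big\}^+,H\Big\},$$ there is $\nu_h^f\in\mathbb R^{d'}$ with $\|\nu_h^f\|_2\le H\sqrt{d'}$ and $\mathbb P_h[f(\cdot,w)](s,a)=\langle\psi(s,a,w),\nu_h^f\rangle$ for all $(s,a,w)$. Moreover $r_h(s,a,w)=\langle\eta_h,\psi(s,a,w)\rangle$ for some $\eta_h\in\mathbb R^{d'}$, $h\in[H]$. 2. (Boundedness.) $\|\psi(s,a,w)\|_2\le1$ for all $(s,a,w)$ and $\|\eta_h\|_2\le\sqrt{d'}$ for all $h\in[H]$. **Algorithm** (standard Lifelong-LSVI with computation sharing,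 parameters $\lambda>0$ and $\beta$). With $\psi_h^\tau=\psi(s_h^\tau,a_h^\tau,w^\tau)$, let $\tilde\Lambda_h^k=\lambda I+\sum_{\tau<k}\psi_h^\tau(\psi_h^\tau)^\top$, $Q_{H+1}^k=0$ and, for $h=H,\dots,1$, $$\tilde\nu_h^k=(\tilde\Lambda_h^k)^{-1}\sum_{\tau<k}\psi_h^\tau\min\Big\{\max_{a\in\mathcal A}Q_{h+1}^k(s_{h+1}^\tau,a,w^\tau),H\Big\},$$ $$Q_h^k(s,a,w)=\Big\{r_h(s,a,w)+\langle\tilde\nu_h^k,\psi(s,a,w)\rangle+\beta\|\psi(s,a,w)\|_{(\tilde\Lambda_h^k)^{-1}}\Big\}^+.$$ Start with $\tilde k=1$. In episode $k$, if $\det\tilde\Lambda_h^k/\det\tilde\Lambda_h^{\tilde k}>e$ for some $h\in[H]$, set $\tilde k=k$ and replan (one planning call, computing $\tilde\nu_h^{\tilde k}$ for all $h$). Then act by a policy with $\pi_h^k(s,w)\in\arg\max_{a}Q_h^{\tilde k}(s,a,w)$ (ties broken in any measurable way that uses only information available when the episode starts). **Theorem.** There are absolute constants $c,C>0$ such that the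 following holds in every such setting. (i) For all $\lambda>0$ and $\beta\in\mathbb R$, the number of planning calls in the $K$ episodes is always at most $d'H\log\big(1+\frac{K}{d'\lambda}\big)$. (ii) For every $\delta\in(0,\frac12)$, if $\lambda=1$ and $\beta=c\,d'H\sqrt{\log(d'T/\delta)}$, then with probability at least $1-2\delta$ $$R_K\le 2H\sqrt{T\log(d'T/\delta)}+4H\beta\sqrt{2d'K\log K},$$ and the right-hand side is at most $C\sqrt{d'^3H^3T}\,\log(d'T/\delta)$, that is, $\tilde O\big(\sqrt{d'^3H^3T}\big)$. -/

import Mathlib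

open MeasureTheory ProbabilityTheory

noncomputable section

namespace LifelongRL

/-- A finite-horizon contextual MDP: transition kernels `P h` (independent of the context) and
reward functions `r h` with range in `[0, 1]`.  Steps are numbered from `0`, so for horizon `H`
only the indices `h < H` matter. -/
structure ContextualMDP (S A W : Type*) [MeasurableSpace S] [MeasurableSpace A]
    [MeasurableSpace W] where
  P : ℕ → Kernel (S × A) S
  markov : ∀ h, IsMarkovKernel (P h)
  r : ℕ → S → A → W → ℝ
  measurable_r : ∀ h, Measurable (fun x : S × A × W => r h x.1 x.2.1 x.2.2)
  r_nonneg : ∀ h s a w, 0 ≤ r h s a w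
  r_le_one : ∀ h s a w, r h s a w ≤ 1

attribute [instance] ContextualMDP.markov

/-- A (deterministic, measurable) policy: `act h (s, w)` is the action played at step `h`. -/
structure Policy (S A W : Type*) [MeasurableSpace S] [MeasurableSpace A]
    [MeasurableSpace W] where
  act : ℕ → S × W → A
  measurable_act : ∀ h, Measurable (act h)

section Values

variable {S A W : Type*} [MeasurableSpace S] [MeasurableSpace A] [MeasurableSpace W]

theorem Policy.measurable_graph (p : Policy S A W) (w : W) (h : ℕ) :
    Measurable (fun s : S => (s, p.act h (s, w))) :=
  measurable_id.prodMk ((p.measurable_act h).comp (measurable_id.prodMk measurable_const))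

/-- The one-step state transition at step `h` under a policy in context `w`. -/
def ContextualMDP.step (M : ContextualMDP S A W) (p : Policy S A W) (w : W) (h : ℕ) :
    Kernel S S :=
  (M.P h).comap (fun s => (s, p.act h (s, w))) (p.measurable_graph w h)

/-- `M.stateLaw p w n h s` is the law of the state `s_{h+n}` given `s_h = s`, when the policy `p`
is followed in context `w`. -/
def ContextualMDP.stateLaw (M : ContextualMDP S A W) (p : Policy S A W) (w : W) :
    ℕ → ℕ → Kernel S S
  | 0, _ => Kernel.id
  | n + 1, h => (M.stateLaw p w n (h + 1)) ∘ₖ (M.step p w h)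

/-- The value function of a policy: the expected sum of the rewards collected at the steps
`h, …, H - 1`, given `s_h = s`. -/
def ContextualMDP.value (M : ContextualMDP S A W) (H : ℕ) (p : Policy S A W) (h : ℕ)
    (s : S) (w : W) : ℝ :=
  ∑ n ∈ Finset.range (H - h),
    ∫ x, M.r (h + n) x (p.act (h + n) (x, w)) w ∂(M.stateLaw p w n h s)

/-- The optimal value function: the supremum of the values of all policies. -/
def ContextualMDP.optValue (M : ContextualMDP S A W) (H : ℕ) (h : ℕ) (s : S) (w : W) : ℝ :=
  ⨆ p : Policy S A W, M.value H p h s w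

end Values

/-- The weighted Euclidean norm `√(xᵀ B x)`. -/
def wnorm {d : ℕ} (B : Matrix (Fin d) (Fin d) ℝ) (x : EuclideanSpace ℝ (Fin d)) : ℝ :=
  Real.sqrt (x.ofLp ⬝ᵥ (B.mulVec x.ofLp))

/-- The maximum over the finite action set. -/
def maxAct {A : Type*} [Fintype A] [Nonempty A] (f : A → ℝ) : ℝ :=
  Finset.univ.sup' Finset.univ_nonempty f

section Assumptions

variable {S A W : Type*} [MeasurableSpace S] [MeasurableSpace A] [MeasurableSpace W]
variable [Fintype A] [Nonempty A]

/-- The class of the functions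
`(s, w) ↦ min {max_a {⟨ν, ψ(s,a,w)⟩ + b ‖ψ(s,a,w)‖_{Λ⁻¹}}⁺, H}`, where `ν` is a vector, `b` a real
number and `Λ` a symmetric positive definite matrix. -/
def valueClass {d : ℕ} (H : ℕ) (ψ : S → A → W → EuclideanSpace ℝ (Fin d)) :
    Set (S → W → ℝ) :=
  {f | ∃ (ν : EuclideanSpace ℝ (Fin d)) (b : ℝ) (L : Matrix (Fin d) (Fin d) ℝ), L.PosDef ∧
    f = fun s w =>
      min (maxAct fun a => max (inner ℝ ν (ψ s a w) + b * wnorm L⁻¹ (ψ s a w)) 0) (H : ℝ)}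

/-- Completeness: backups of functions in the class are linear in `ψ` with bounded parameters, and
the rewards are linear in `ψ` with parameters `η h`. -/
structure Completeness {d : ℕ} (M : ContextualMDP S A W) (H : ℕ)
    (ψ : S → A → W → EuclideanSpace ℝ (Fin d)) (η : ℕ → EuclideanSpace ℝ (Fin d)) : Prop where
  backup : ∀ f ∈ valueClass H ψ, ∀ h < H, ∃ ν : EuclideanSpace ℝ (Fin d),
    ‖ν‖ ≤ H * Real.sqrt d ∧
      ∀ s a w, ∫ s', f s' w ∂(M.P h (s, a)) = inner ℝ (ψ s a w) ν
  reward : ∀ h < H, ∀ s a w, M.r h s a w = inner ℝ (η h) (ψ s a w)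

/-- Boundedness of the features and of the reward parameters. -/
structure Boundedness {d : ℕ} (H : ℕ)
    (ψ : S → A → W → EuclideanSpace ℝ (Fin d)) (η : ℕ → EuclideanSpace ℝ (Fin d)) : Prop where
  feature : ∀ s a w, ‖ψ s a w‖ ≤ 1
  reward : ∀ h < H, ‖η h‖ ≤ Real.sqrt d

end Assumptions

/-- The data of the episodes: `state k h`, `action k h` and the context `ctx k`.  Episodes and steps
are numbered from `0`. -/
structure Log (S A W : Type*) where
  state : ℕ → ℕ → S
  action : ℕ → ℕ → A
  ctx : ℕ → W

section Algorithm

variable {S A W : Type*} {d : ℕ}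

/-- The feature `ψ(s_h^τ, a_h^τ, w^τ)`. -/
def Log.feature (D : Log S A W) (ψ : S → A → W → EuclideanSpace ℝ (Fin d)) (h τ : ℕ) :
    EuclideanSpace ℝ (Fin d) :=
  ψ (D.state τ h) (D.action τ h) (D.ctx τ)

/-- The regularized Gram matrix at step `h` from the episodes before episode `k`. -/
def gram (ψ : S → A → W → EuclideanSpace ℝ (Fin d)) (lam : ℝ) (D : Log S A W) (h k : ℕ) :
    Matrix (Fin d) (Fin d) ℝ :=
  lam • (1 : Matrix (Fin d) (Fin d) ℝ) +
    ∑ τ ∈ Finset.range k,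
      Matrix.vecMulVec (D.feature ψ h τ).ofLp (D.feature ψ h τ).ofLp

/-- The replanning test of episode `k`, when the last planning took place in episode `k'`. -/
def Replan (H : ℕ) (ψ : S → A → W → EuclideanSpace ℝ (Fin d)) (lam : ℝ) (D : Log S A W)
    (k k' : ℕ) : Prop :=
  ∃ h < H, (gram ψ lam D h k).det / (gram ψ lam D h k').det > Real.exp 1

open Classical in
/-- The value of the variable `k̃` of the algorithm just before episode `k`. -/
def planBefore (H : ℕ) (ψ : S → A → W → EuclideanSpace ℝ (Fin d)) (lam : ℝ) (D : Log S A W) :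
    ℕ → ℕ
  | 0 => 0
  | k + 1 =>
    if Replan H ψ lam D k (planBefore H ψ lam D k) then k else planBefore H ψ lam D k

/-- The value of `k̃` used for acting in episode `k`, i.e. after the replanning test. -/
def planUsed (H : ℕ) (ψ : S → A → W → EuclideanSpace ℝ (Fin d)) (lam : ℝ) (D : Log S A W)
    (k : ℕ) : ℕ :=
  planBefore H ψ lam D (k + 1)

open Classical in
/-- The number of planning calls in the first `K` episodes. -/
def planningCalls (H : ℕ) (ψ : S → A → W → EuclideanSpace ℝ (Fin d)) (lam : ℝ)
    (D : Log S A W) (K : ℕ) : ℕ :=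
  ((Finset.range K).filter
    fun k => Replan H ψ lam D k (planBefore H ψ lam D k)).card

variable [Fintype A] [Nonempty A]

/-- The action-value function `Q_h^k`, computed backwards in `h` from the data of the episodes before
episode `k`; it vanishes for `h ≥ H`. -/
def Qfun (r : ℕ → S → A → W → ℝ) (H : ℕ) (ψ : S → A → W → EuclideanSpace ℝ (Fin d))
    (lam β : ℝ) (D : Log S A W) (k h : ℕ) : S → A → W → ℝ :=
  if _hh : h < H then
    let G := gram ψ lam D h k
    let ν : EuclideanSpace ℝ (Fin d) := WithLp.toLp 2 (G⁻¹.mulVec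
      (∑ τ ∈ Finset.range k,
        min (maxAct fun a =>
            Qfun r H ψ lam β D k (h + 1) (D.state τ (h + 1)) a (D.ctx τ)) (H : ℝ) •
          (D.feature ψ h τ).ofLp))
    fun s a w =>
      max (r h s a w + inner ℝ ν (ψ s a w) + β * wnorm G⁻¹ (ψ s a w)) 0
  else fun _ _ _ => 0
  termination_by H - h

end Algorithm

/-- The time at which the state at step `h` of episode `k` is known, counted over all episodes; an
episode takes up the `H + 1` times of its states `s_0, …, s_H`. -/
def clock (H k h : ℕ) : ℕ := k * (H + 1) + h

section Protocol

variable {S A W : Type*} [MeasurableSpace S] [MeasurableSpace A] [MeasurableSpace W]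
variable {Ω : Type*} [mΩ : MeasurableSpace Ω]

/-- The lifelong interaction protocol over `K` episodes of length `H`.  The information available at
each time is a filtration.  The context and the initial state of an episode are arbitrary random
elements known when the episode starts (so they may depend on everything that happened before);
the policy of the episode is fixed at that time; and, given the information at step `h`, the next
state has law `P_h(· | s_h, a_h)`, where `a_h` is the action of the policy. -/
structure Interaction (M : ContextualMDP S A W) (H K : ℕ) (μ : Measure Ω) where
  filt : Filtration ℕ mΩ
  state : ℕ → ℕ → Ω → S
  ctx : ℕ → Ω → W
  policy : ℕ → Ω → Policy S A W
  measurable_state : ∀ k < K, ∀ h ≤ H, Measurable[filt (clock H k h)] (state k h)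
  measurable_ctx : ∀ k < K, Measurable[filt (clock H k 0)] (ctx k)
  measurable_policy : ∀ k < K, ∀ h < H,
    Measurable[(filt (clock H k 0)).prod (inferInstance : MeasurableSpace (S × W))]
      (fun x : Ω × (S × W) => (policy k x.1).act h x.2)
  transition : ∀ k < K, ∀ h < H, ∀ B : Set S, MeasurableSet B →
    μ[(state k (h + 1) ⁻¹' B).indicator (fun _ => (1 : ℝ)) | filt (clock H k h)] =ᵐ[μ]
      fun ω => (M.P h (state k h ω, (policy k ω).act h (state k h ω, ctx k ω))).real B

variable {M : ContextualMDP S A W} {H K : ℕ} {μ : Measure Ω}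

/-- The data generated by the interaction, for the outcome `ω`. -/
def Interaction.log (I : Interaction M H K μ) (ω : Ω) : Log S A W where
  state k h := I.state k h ω
  action k h := (I.policy k ω).act h (I.state k h ω, I.ctx k ω)
  ctx k := I.ctx k ω

/-- The regret over the `K` episodes. -/
def Interaction.regret (I : Interaction M H K μ) (ω : Ω) : ℝ :=
  ∑ k ∈ Finset.range K,
    (M.optValue H 0 (I.state k 0 ω) (I.ctx k ω) -
      M.value H (I.policy k ω) 0 (I.state k 0 ω) (I.ctx k ω))

/-- The agent runs standard Lifelong-LSVI with computation sharing: in episode `k` its policy is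
greedy (ties being broken in any way) with respect to `Q^{k̃}`. -/
def Interaction.RunsLSVI [Fintype A] [Nonempty A] {d : ℕ} (I : Interaction M H K μ)
    (ψ : S → A → W → EuclideanSpace ℝ (Fin d)) (lam β : ℝ) : Prop :=
  ∀ k < K, ∀ h < H, ∀ ω s w a,
    Qfun M.r H ψ lam β (I.log ω) (planUsed H ψ lam (I.log ω) k) h s a w ≤
      Qfun M.r H ψ lam β (I.log ω) (planUsed H ψ lam (I.log ω) k) h s
        ((I.policy k ω).act h (s, w)) w

end Protocol

end LifelongRL

end

noncomputable section

namespace LifelongRL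

/-! ### Positive definite matrices and rank-one updates. -/

section LinearAlgebra

open Matrix

variable {d : ℕ}

/-! Planning calls are counted by the potential `∑ h, log det Λ_h` at the last planning episode.
Each call raises one summand by at least 1 and lowers none, and the inequality between determinant
and trace caps the growth of each summand at `d log (1 + K/(dλ))` (`planningCalls_le_potential`,
`log_det_gram_sub_le`).

The core of the regret bound is that, with high probability, every least-squares estimate of the
backup of the algorithm's own value function is accurate up to `β ‖ψ‖` in the inverse Gram norm
(`NetGood.abs_backup_sub_le`). By completeness the true backup is linear in `ψ`, so the error is a
ridge bias, at most `H √d`, plus a self-normalized noise vector. The value function depends on the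
data it is regressed on, so the noise is compared with that of deterministic functions from a net of
parameters `(ν, B)`. For a fixed function and a fixed direction `x`, Hoeffding's lemma yields an
exponential supermartingale with explicit quadratic compensator. The net also runs over `x`;
evaluating near the random direction proportional to `Λ⁻¹ z`, with `z` the noise vector, gives the
self-normalized bound with no mixture argument (`quad_noise_le`). The log-cardinality of the net is
of order `d² log (dT/δ)`, the square coming from the matrix parameter; hence `β` is of order `d H
√log (dT/δ)`.

Accuracy implies optimism (`Accurate.value_le_Vfun`). Unrolling Bellman's equation along the played
trajectory bounds the regret by `2β` times the sum of the bonuses plus a martingale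
(`Interaction.regret_le`). The martingale is handled by Azuma-Hoeffding
(`Interaction.measure_noise_le`). The bonuses use outdated Gram matrices, but the replanning test
keeps the determinant ratios below `e`, so squared bonuses grow at most by the factor `e` and the
elliptical potential argument applies (`sum_wnorm_planUsed_le`). -/

theorem cauchySchwarz_dotProduct {A : Matrix (Fin d) (Fin d) ℝ} (hA : A.PosDef)
    (v y : Fin d → ℝ) : (v ⬝ᵥ y) ^ 2 ≤ (v ⬝ᵥ A⁻¹ *ᵥ v) * (y ⬝ᵥ A *ᵥ y) := by
  have hu : IsUnit A.det := (isUnit_iff_isUnit_det A).1 hA.isUnit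
  have hT : Aᵀ = A := (conjTranspose_eq_transpose_of_trivial A).symm.trans hA.isHermitian.eq
  have hAv : A *ᵥ (A⁻¹ *ᵥ v) = v := by
    rw [mulVec_mulVec, mul_nonsing_inv A hu, one_mulVec]
  -- The quadratic form of `A` at `y + s A⁻¹ v` is a nonnegative quadratic polynomial in `s`.
  have h := discrim_le_zero (a := v ⬝ᵥ A⁻¹ *ᵥ v) (b := 2 * (v ⬝ᵥ y)) (c := y ⬝ᵥ A *ᵥ y) fun s => by
    have h0 := hA.posSemidef.dotProduct_mulVec_nonneg (y + s • (A⁻¹ *ᵥ v))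
    have h1 : (A⁻¹ *ᵥ v) ⬝ᵥ A *ᵥ y = v ⬝ᵥ y := by
      rw [dotProduct_mulVec, ← mulVec_transpose, hT, hAv]
    simp only [star_trivial, mulVec_add, mulVec_smul, hAv, dotProduct_add, add_dotProduct,
      dotProduct_smul, smul_dotProduct, smul_eq_mul, h1] at h0
    rw [dotProduct_comm y v, dotProduct_comm (A⁻¹ *ᵥ v) v] at h0
    linarith
  unfold discrim at h
  linarith

theorem posDef_mulVec_inv_mulVec {A : Matrix (Fin d) (Fin d) ℝ} (hA : A.PosDef)
    (v : Fin d → ℝ) : A *ᵥ (A⁻¹ *ᵥ v) = v := by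
  rw [mulVec_mulVec, mul_nonsing_inv A ((isUnit_iff_isUnit_det A).1 hA.isUnit), one_mulVec]

theorem posDef_inv_mulVec_mulVec {A : Matrix (Fin d) (Fin d) ℝ} (hA : A.PosDef)
    (v : Fin d → ℝ) : A⁻¹ *ᵥ (A *ᵥ v) = v := by
  rw [mulVec_mulVec, nonsing_inv_mul A ((isUnit_iff_isUnit_det A).1 hA.isUnit), one_mulVec]

theorem posDef_dotProduct_mulVec_comm {A : Matrix (Fin d) (Fin d) ℝ} (hA : A.PosDef)
    (x y : Fin d → ℝ) : x ⬝ᵥ A *ᵥ y = y ⬝ᵥ A *ᵥ x := by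
  have hT : Aᵀ = A := (conjTranspose_eq_transpose_of_trivial A).symm.trans hA.isHermitian.eq
  rw [dotProduct_mulVec, ← mulVec_transpose, hT, dotProduct_comm]

theorem posDef_quad_nonneg {A : Matrix (Fin d) (Fin d) ℝ} (hA : A.PosDef)
    (x : Fin d → ℝ) : 0 ≤ x ⬝ᵥ A *ᵥ x := by
  simpa using hA.posSemidef.dotProduct_mulVec_nonneg x

theorem posDef_add_vecMulVec {A : Matrix (Fin d) (Fin d) ℝ} (hA : A.PosDef)
    (v : Fin d → ℝ) : (A + vecMulVec v v).PosDef :=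
  hA.add_posSemidef (by simpa using posSemidef_vecMulVec_self_star v)

theorem det_add_vecMulVec {A : Matrix (Fin d) (Fin d) ℝ} (hA : A.PosDef) (v : Fin d → ℝ) :
    (A + vecMulVec v v).det = A.det * (1 + v ⬝ᵥ A⁻¹ *ᵥ v) := by
  have hu : IsUnit A.det := (isUnit_iff_isUnit_det A).1 hA.isUnit
  rw [vecMulVec_eq Unit, det_add_replicateCol_mul_replicateRow hu, det_unique (n := Unit), Matrix.mul_assoc]
  congr 1

/-- After the substitution `x = (A + v vᵀ) y`, the difference of the two sides is `(v ⬝ A⁻¹ v)(y ⬝ A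
y) - (v ⬝ y)²`, which is nonnegative by Cauchy-Schwarz. -/
theorem quad_inv_le_rankOne {A : Matrix (Fin d) (Fin d) ℝ} (hA : A.PosDef) (v x : Fin d → ℝ) :
    x ⬝ᵥ A⁻¹ *ᵥ x ≤ (1 + v ⬝ᵥ A⁻¹ *ᵥ v) * (x ⬝ᵥ (A + vecMulVec v v)⁻¹ *ᵥ x) := by
  have hB := posDef_add_vecMulVec hA v
  obtain ⟨y, rfl⟩ : ∃ y, x = (A + vecMulVec v v) *ᵥ y :=
    ⟨_, (posDef_mulVec_inv_mulVec hB x).symm⟩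
  rw [posDef_inv_mulVec_mulVec hB]
  have e : (A + vecMulVec v v) *ᵥ y = A *ᵥ y + (v ⬝ᵥ y) • v := by
    rw [add_mulVec, vecMulVec_mulVec]
    simp
  have cs := cauchySchwarz_dotProduct hA v y
  have h1 : (A *ᵥ y) ⬝ᵥ A⁻¹ *ᵥ v = v ⬝ᵥ y := by
    rw [posDef_dotProduct_mulVec_comm hA.inv, posDef_inv_mulVec_mulVec hA]
  simp only [e, mulVec_add, mulVec_smul, posDef_inv_mulVec_mulVec hA, dotProduct_add,
    add_dotProduct, dotProduct_smul, smul_dotProduct, smul_eq_mul, h1]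
  rw [dotProduct_comm (A *ᵥ y) y]
  nlinarith

/-- This is the AM-GM inequality for the eigenvalues, obtained from the tangent of `log` at `t`. -/
theorem log_det_le {A : Matrix (Fin d) (Fin d) ℝ} (hA : A.PosDef) {t : ℝ} (ht : 0 < t)
    (htr : A.trace ≤ d * t) : Real.log A.det ≤ d * Real.log t := by
  have h1 : A.det = ∏ i, hA.isHermitian.eigenvalues i := by
    simpa using hA.isHermitian.det_eq_prod_eigenvalues
  have h2 : A.trace = ∑ i, hA.isHermitian.eigenvalues i := by
    simpa using hA.isHermitian.trace_eq_sum_eigenvalues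
  have hp := hA.eigenvalues_pos
  rw [h1, Real.log_prod fun i _ => (hp i).ne']
  have h3 : ∀ i, Real.log (hA.isHermitian.eigenvalues i) ≤
      hA.isHermitian.eigenvalues i / t - 1 + Real.log t := fun i => by
    have := Real.log_le_sub_one_of_pos (div_pos (hp i) ht)
    rw [Real.log_div (hp i).ne' ht.ne'] at this
    linarith
  refine (Finset.sum_le_sum fun i _ => h3 i).trans ?_
  simp only [Finset.sum_add_distrib, Finset.sum_sub_distrib, ← Finset.sum_div, ← h2,
    Finset.sum_const, Finset.card_univ, Fintype.card_fin, nsmul_eq_mul, mul_one]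
  have : A.trace / t ≤ d := by rwa [div_le_iff₀ ht]
  linarith

end LinearAlgebra

/-! ### Gram matrices, the count of planning calls and the elliptical potential. -/

section Gram

open Matrix

variable {S A W : Type*} {d : ℕ} (ψ : S → A → W → EuclideanSpace ℝ (Fin d)) {lam : ℝ}
  (D : Log S A W) (h : ℕ)

theorem gram_zero : gram ψ lam D h 0 = lam • (1 : Matrix (Fin d) (Fin d) ℝ) := by
  simp [gram]

theorem gram_succ (k : ℕ) : gram ψ lam D h (k + 1) =
    gram ψ lam D h k + vecMulVec (D.feature ψ h k).ofLp (D.feature ψ h k).ofLp := by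
  simp [gram, Finset.sum_range_succ, add_assoc]

theorem gram_posDef (hl : 0 < lam) (k : ℕ) : (gram ψ lam D h k).PosDef := by
  induction k with
  | zero => rw [gram_zero]; exact PosDef.one.smul hl
  | succ k ih => rw [gram_succ]; exact posDef_add_vecMulVec ih _

/-- The squared elliptical norm of the feature of episode `k`. -/
def bonusSq (lam : ℝ) (k : ℕ) : ℝ :=
  (D.feature ψ h k).ofLp ⬝ᵥ (gram ψ lam D h k)⁻¹ *ᵥ (D.feature ψ h k).ofLp

theorem bonusSq_nonneg (hl : 0 < lam) (k : ℕ) : 0 ≤ bonusSq ψ D h lam k :=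
  posDef_quad_nonneg (gram_posDef ψ D h hl k).inv _

theorem det_gram_succ (hl : 0 < lam) (k : ℕ) : (gram ψ lam D h (k + 1)).det =
    (gram ψ lam D h k).det * (1 + bonusSq ψ D h lam k) := by
  rw [gram_succ, det_add_vecMulVec (gram_posDef ψ D h hl k)]
  rfl

theorem det_gram_mono (hl : 0 < lam) {j k : ℕ} (hjk : j ≤ k) :
    (gram ψ lam D h j).det ≤ (gram ψ lam D h k).det := by
  induction k, hjk using Nat.le_induction with
  | base => exact le_rfl
  | succ k _ ih =>
    rw [det_gram_succ ψ D h hl]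
    refine ih.trans (le_mul_of_one_le_right (gram_posDef ψ D h hl k).det_pos.le ?_)
    linarith [bonusSq_nonneg ψ D h hl k]

/-- The loss factor in `quad_inv_le_rankOne` is exactly the ratio of consecutive determinants, so
the factors telescope. -/
theorem quad_gram_inv_le (hl : 0 < lam) {j k : ℕ} (hjk : j ≤ k) (x : Fin d → ℝ) :
    x ⬝ᵥ (gram ψ lam D h j)⁻¹ *ᵥ x ≤
      (gram ψ lam D h k).det / (gram ψ lam D h j).det * (x ⬝ᵥ (gram ψ lam D h k)⁻¹ *ᵥ x) := by
  have hj := (gram_posDef ψ D h hl j).det_pos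
  induction k, hjk using Nat.le_induction with
  | base => rw [div_self hj.ne', one_mul]
  | succ k hk ih =>
    refine ih.trans ?_
    have := quad_inv_le_rankOne (gram_posDef ψ D h hl k) (D.feature ψ h k).ofLp x
    rw [← gram_succ] at this
    rw [det_gram_succ ψ D h hl, mul_div_right_comm, mul_assoc]
    exact mul_le_mul_of_nonneg_left this
      (div_nonneg (gram_posDef ψ D h hl k).det_pos.le hj.le)

theorem norm_sq_eq_dotProduct (x : EuclideanSpace ℝ (Fin d)) : ‖x‖ ^ 2 = x.ofLp ⬝ᵥ x.ofLp := by
  rw [EuclideanSpace.real_norm_sq_eq]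
  simp [dotProduct, sq]

theorem inner_eq_dotProduct (x y : EuclideanSpace ℝ (Fin d)) :
    inner ℝ x y = x.ofLp ⬝ᵥ y.ofLp := by
  rw [EuclideanSpace.inner_eq_star_dotProduct, dotProduct_comm]
  simp

theorem quad_gram (k : ℕ) (x : Fin d → ℝ) : x ⬝ᵥ gram ψ lam D h k *ᵥ x =
    lam * (x ⬝ᵥ x) + ∑ τ ∈ Finset.range k, (x ⬝ᵥ (D.feature ψ h τ).ofLp) ^ 2 := by
  induction k with
  | zero => simp [gram_zero, smul_mulVec]
  | succ k ih =>
    rw [gram_succ, add_mulVec, dotProduct_add, ih, Finset.sum_range_succ, vecMulVec_mulVec]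
    simp only [op_smul_eq_smul, dotProduct_smul, smul_eq_mul]
    rw [dotProduct_comm (D.feature ψ h k).ofLp x]
    ring

variable {ψ} in
theorem log_det_gram_sub_le (hψ : ∀ s a w, ‖ψ s a w‖ ≤ 1) (hd : 0 < d) (hl : 0 < lam) (k : ℕ) :
    Real.log (gram ψ lam D h k).det - Real.log (gram ψ lam D h 0).det ≤
      d * Real.log (1 + k / (d * lam)) := by
  have hd' : (0 : ℝ) < d := by exact_mod_cast hd
  have htr : (gram ψ lam D h k).trace ≤ d * (lam + k / d) := by
    have e : (d : ℝ) * (lam + k / d) = d * lam + k := by field_simp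
    rw [e, gram, trace_add, trace_sum, trace_smul, trace_one]
    simp only [trace_vecMulVec, Fintype.card_fin, smul_eq_mul]
    have : ∑ τ ∈ Finset.range k, (D.feature ψ h τ).ofLp ⬝ᵥ (D.feature ψ h τ).ofLp ≤
        ∑ τ ∈ Finset.range k, (1 : ℝ) := by
      refine Finset.sum_le_sum fun τ _ => ?_
      rw [← norm_sq_eq_dotProduct]
      exact pow_le_one₀ (norm_nonneg _) (hψ _ _ _)
    simp only [Finset.sum_const, Finset.card_range, nsmul_eq_mul, mul_one] at this
    linarith
  have h1 := log_det_le (gram_posDef ψ D h hl k) (by positivity) htr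
  have h2 : Real.log (gram ψ lam D h 0).det = d * Real.log lam := by
    rw [gram_zero, det_smul, det_one, mul_one, Fintype.card_fin, Real.log_pow]
  have h3 : Real.log (lam + k / d) = Real.log lam + Real.log (1 + k / (d * lam)) := by
    rw [← Real.log_mul hl.ne' (by positivity)]
    congr 1
    field_simp
  rw [h2]
  rw [h3] at h1
  linarith

theorem planBefore_le (H : ℕ) (k : ℕ) : planBefore H ψ lam D k ≤ k := by
  induction k with
  | zero => simp [planBefore]
  | succ k ih =>
    rw [planBefore]
    split_ifs <;> omega

theorem planUsed_le (H : ℕ) (k : ℕ) : planUsed H ψ lam D k ≤ k := by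
  have := planBefore_le ψ (lam := lam) D H k
  rw [planUsed, planBefore]
  split_ifs <;> omega

theorem det_div_planUsed_le (hl : 0 < lam) {H : ℕ} {h : ℕ} (hh : h < H) (k : ℕ) :
    (gram ψ lam D h k).det / (gram ψ lam D h (planUsed H ψ lam D k)).det ≤ Real.exp 1 := by
  rw [planUsed, planBefore]
  split_ifs with hr
  · rw [div_self (gram_posDef ψ D h hl k).det_pos.ne']
    exact Real.one_le_exp zero_le_one
  · unfold Replan at hr
    push Not at hr
    exact hr h hh

open Classical in
-- At a call the test gives a log-determinant gain of at least 1 at some step, while at the other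
-- steps the determinants do not decrease. Without a call nothing changes.
theorem planningCalls_le_potential (hl : 0 < lam) (H K : ℕ) :
    (planningCalls H ψ lam D K : ℝ) ≤ ∑ h ∈ Finset.range H,
      (Real.log (gram ψ lam D h (planBefore H ψ lam D K)).det
        - Real.log (gram ψ lam D h 0).det) := by
  induction K with
  | zero => simp [planningCalls, planBefore]
  | succ K ih =>
    have hc : planningCalls H ψ lam D (K + 1) = planningCalls H ψ lam D K +
        if Replan H ψ lam D K (planBefore H ψ lam D K) then 1 else 0 := by
      unfold planningCalls
      rw [Finset.range_add_one, Finset.filter_insert]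
      split_ifs <;> simp
    rw [hc, planBefore]
    split_ifs with hr
    · push_cast
      refine (add_le_add_left ih 1).trans ?_
      obtain ⟨h, hh, hgt⟩ := hr
      set p := planBefore H ψ lam D K
      rw [← sub_nonneg, ← sub_sub, ← Finset.sum_sub_distrib, sub_nonneg]
      have hpos : ∀ h k, 0 < (gram ψ lam D h k).det := fun h k => (gram_posDef ψ D h hl k).det_pos
      have hone : 1 ≤ Real.log (gram ψ lam D h K).det - Real.log (gram ψ lam D h p).det := by
        rw [← Real.log_div (hpos _ _).ne' (hpos _ _).ne', Real.le_log_iff_exp_le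
          (div_pos (hpos _ _) (hpos _ _))]
        exact hgt.le
      refine hone.trans ?_
      have := Finset.single_le_sum (s := Finset.range H)
        (f := fun h => Real.log (gram ψ lam D h K).det - Real.log (gram ψ lam D h p).det)
        (fun h _ => sub_nonneg.2 (Real.log_le_log (hpos _ _)
          (det_gram_mono ψ D h hl (planBefore_le ψ D H K)))) (Finset.mem_range.2 hh)
      refine this.trans (le_of_eq (Finset.sum_congr rfl fun i _ => by ring))
    · simpa using ih

variable {ψ} in
theorem planningCalls_le (hψ : ∀ s a w, ‖ψ s a w‖ ≤ 1) (hd : 0 < d) (hl : 0 < lam) (H K : ℕ) :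
    (planningCalls H ψ lam D K : ℝ) ≤ d * H * Real.log (1 + K / (d * lam)) := by
  have hd' : (0 : ℝ) < d := by exact_mod_cast hd
  refine (planningCalls_le_potential ψ D hl H K).trans ?_
  refine (Finset.sum_le_sum fun h _ => log_det_gram_sub_le D h hψ hd hl _).trans ?_
  rw [Finset.sum_const, Finset.card_range, nsmul_eq_mul, mul_comm (d : ℝ) H, mul_assoc]
  have : (planBefore H ψ lam D K : ℝ) ≤ K := by exact_mod_cast planBefore_le ψ D H K
  gcongr

/-- With `λ = 1` the Gram matrix dominates the identity, so its inverse is a contraction. -/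
theorem norm_gram_inv_mulVec_le (k : ℕ) (x : EuclideanSpace ℝ (Fin d)) :
    ‖(WithLp.toLp 2 ((gram ψ 1 D h k)⁻¹ *ᵥ x.ofLp) : EuclideanSpace ℝ (Fin d))‖ ≤ ‖x‖ := by
  have hG := gram_posDef ψ D h one_pos k
  set y : EuclideanSpace ℝ (Fin d) := WithLp.toLp 2 ((gram ψ 1 D h k)⁻¹ *ᵥ x.ofLp) with hy
  have hx : x.ofLp = gram ψ 1 D h k *ᵥ y.ofLp := (posDef_mulVec_inv_mulVec hG _).symm
  have h1 : inner ℝ y x = y.ofLp ⬝ᵥ gram ψ 1 D h k *ᵥ y.ofLp := by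
    rw [inner_eq_dotProduct, hx]
  have h2 : ‖y‖ ^ 2 ≤ inner ℝ y x := by
    rw [h1, quad_gram, norm_sq_eq_dotProduct, one_mul]
    exact le_add_of_nonneg_right (Finset.sum_nonneg fun _ _ => sq_nonneg _)
  have h3 := h2.trans (real_inner_le_norm y x)
  rcases (norm_nonneg y).eq_or_lt with h0 | h0
  · rw [← h0]; exact norm_nonneg _
  · rw [sq] at h3
    exact le_of_mul_le_mul_left h3 h0

theorem quad_gram_inv_le_norm_sq (k : ℕ) (x : EuclideanSpace ℝ (Fin d)) :
    x.ofLp ⬝ᵥ (gram ψ 1 D h k)⁻¹ *ᵥ x.ofLp ≤ ‖x‖ ^ 2 := by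
  have h1 := real_inner_le_norm x (WithLp.toLp 2 ((gram ψ 1 D h k)⁻¹ *ᵥ x.ofLp))
  rw [inner_eq_dotProduct] at h1
  refine h1.trans ?_
  rw [sq]
  exact mul_le_mul_of_nonneg_left (norm_gram_inv_mulVec_le ψ D h k x) (norm_nonneg _)

theorem wnorm_sq {B : Matrix (Fin d) (Fin d) ℝ} (hB : B.PosDef) (x : EuclideanSpace ℝ (Fin d)) :
    wnorm B x ^ 2 = x.ofLp ⬝ᵥ B *ᵥ x.ofLp :=
  Real.sq_sqrt (posDef_quad_nonneg hB _)

variable {ψ} in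
-- Summing `log (1 + q_k)` telescopes to a log-determinant difference. Each squared bonus `q_k` lies
-- in `[0, 1]`, where concavity puts `log (1 + q)` above its chord `q log 2`.
theorem sum_bonusSq_le (hψ : ∀ s a w, ‖ψ s a w‖ ≤ 1) (hd : 0 < d) (K : ℕ) :
    ∑ k ∈ Finset.range K, bonusSq ψ D h 1 k ≤ d * Real.log (1 + K / d) / Real.log 2 := by
  have hl2 : 0 < Real.log 2 := Real.log_pos one_lt_two
  have key : ∀ q : ℝ, 0 ≤ q → q ≤ 1 → q * Real.log 2 ≤ Real.log (1 + q) := fun q h0 h1 => by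
    have := strictConcaveOn_log_Ioi.concaveOn.2 (x := 1) (y := 2) (by simp) (by simp)
      (sub_nonneg.2 h1) h0 (by ring)
    simp only [smul_eq_mul, Real.log_one, mul_zero, zero_add, mul_one] at this
    rwa [show 1 - q + q * 2 = 1 + q by ring] at this
  have htel : ∀ n, ∑ k ∈ Finset.range n, Real.log (1 + bonusSq ψ D h 1 k) =
      Real.log (gram ψ 1 D h n).det - Real.log (gram ψ 1 D h 0).det := fun n => by
    induction n with
    | zero => simp
    | succ n ih =>
      rw [Finset.sum_range_succ, ih, det_gram_succ ψ D h one_pos,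
        Real.log_mul (gram_posDef ψ D h one_pos n).det_pos.ne'
          (by linarith [bonusSq_nonneg ψ D h one_pos n])]
      ring
  rw [le_div_iff₀ hl2, Finset.sum_mul]
  have h1 := log_det_gram_sub_le D h hψ hd one_pos K
  rw [mul_one] at h1
  refine le_trans ?_ h1
  rw [← htel]
  refine Finset.sum_le_sum fun k _ => key _ (bonusSq_nonneg ψ D h one_pos k) ?_
  exact (quad_gram_inv_le_norm_sq ψ D h k _).trans (pow_le_one₀ (norm_nonneg _) (hψ _ _ _))

variable {ψ} in
/-- The bonuses along the trajectory, computed with the rarely updated Gram matrices. -/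
theorem sum_wnorm_planUsed_le (hψ : ∀ s a w, ‖ψ s a w‖ ≤ 1) (hd : 0 < d) {H K : ℕ} (hK : 2 ≤ K)
    (hh : h < H) :
    ∑ k ∈ Finset.range K, wnorm (gram ψ 1 D h (planUsed H ψ 1 D k))⁻¹ (D.feature ψ h k) ≤
      2 * Real.sqrt (2 * d * K * Real.log K) := by
  have hd' : (1 : ℝ) ≤ d := by exact_mod_cast hd
  have hK' : (2 : ℝ) ≤ K := by exact_mod_cast hK
  have hl2 : 0 < Real.log 2 := Real.log_pos one_lt_two
  have hlK : 0 ≤ Real.log K := Real.log_nonneg (by linarith)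
  have h1 : ∀ k, wnorm (gram ψ 1 D h (planUsed H ψ 1 D k))⁻¹ (D.feature ψ h k) ^ 2 ≤
      Real.exp 1 * bonusSq ψ D h 1 k := fun k => by
    rw [wnorm_sq (gram_posDef ψ D h one_pos _).inv]
    exact (quad_gram_inv_le ψ D h one_pos (planUsed_le ψ D H k) _).trans
      (mul_le_mul_of_nonneg_right (det_div_planUsed_le ψ D one_pos hh k)
        (bonusSq_nonneg ψ D h one_pos k))
  -- Here `1 + K ≤ K²` is needed, which fails for `K = 1`.
  have h2 : Real.log (1 + K / d) ≤ 2 * Real.log K := by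
    rw [show (2 : ℝ) * Real.log K = Real.log (K ^ 2) by rw [Real.log_pow]; norm_num]
    refine Real.log_le_log (by positivity) ?_
    have : (K : ℝ) / d ≤ K := div_le_self (by linarith) hd'
    nlinarith
  refine (abs_le_of_sq_le_sq' ?_ (by positivity)).2
  refine (sq_sum_le_card_mul_sum_sq (s := Finset.range K)).trans ?_
  rw [mul_pow, Real.sq_sqrt (by positivity), Finset.card_range]
  have h3 : ∑ k ∈ Finset.range K, wnorm (gram ψ 1 D h (planUsed H ψ 1 D k))⁻¹ (D.feature ψ h k) ^ 2
      ≤ Real.exp 1 * (d * Real.log (1 + K / d) / Real.log 2) := by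
    refine (Finset.sum_le_sum fun k _ => h1 k).trans ?_
    rw [← Finset.mul_sum]
    exact mul_le_mul_of_nonneg_left (sum_bonusSq_le D h hψ hd K) (Real.exp_pos 1).le
  -- Three losses combine: `e` from the outdated matrices, `2` from `log (1 + K/d) ≤ 2 log K`, and
  -- `1 / log 2` from the chord. Numerically `2e ≤ 8 log 2`.
  have h4 : Real.exp 1 * (d * Real.log (1 + K / d) / Real.log 2) ≤ 8 * d * Real.log K := by
    rw [← mul_div_assoc, div_le_iff₀ hl2]
    have he := Real.exp_one_lt_d9
    have hl := Real.log_two_gt_d9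
    have hdl : 0 ≤ d * Real.log K := by positivity
    calc Real.exp 1 * (d * Real.log (1 + K / d)) ≤ Real.exp 1 * (d * (2 * Real.log K)) := by gcongr
      _ = (Real.exp 1 * 2) * (d * Real.log K) := by ring
      _ ≤ (8 * Real.log 2) * (d * Real.log K) := by
        refine mul_le_mul_of_nonneg_right ?_ hdl
        linarith
      _ = _ := by ring
  calc (K : ℝ) * _ ≤ K * (8 * d * Real.log K) :=
        mul_le_mul_of_nonneg_left (h3.trans h4) (by positivity)
    _ = 2 ^ 2 * (2 * d * K * Real.log K) := by ring

end Gram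

/-! ### Values of policies. -/

section ValueFunctions

variable {S A W : Type*} [MeasurableSpace S] [MeasurableSpace A] [MeasurableSpace W]
  (M : ContextualMDP S A W) (H : ℕ) (p : Policy S A W) (w : W)

instance ContextualMDP.isMarkovKernel_step (h : ℕ) : IsMarkovKernel (M.step p w h) := by
  unfold ContextualMDP.step; infer_instance

instance ContextualMDP.isMarkovKernel_stateLaw (n h : ℕ) :
    IsMarkovKernel (M.stateLaw p w n h) := by
  induction n generalizing h with
  | zero => unfold ContextualMDP.stateLaw; infer_instance
  | succ n ih =>
    have := ih (h + 1)
    unfold ContextualMDP.stateLaw; infer_instance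

theorem ContextualMDP.measurable_reward (h : ℕ) :
    Measurable fun s => M.r h s (p.act h (s, w)) w :=
  (M.measurable_r h).comp (measurable_id.prodMk
    (((p.measurable_act h).comp (measurable_id.prodMk measurable_const)).prodMk
      measurable_const))

theorem ContextualMDP.integrable_reward (h : ℕ) (ν : Measure S) [IsFiniteMeasure ν] :
    Integrable (fun s => M.r h s (p.act h (s, w)) w) ν :=
  Integrable.of_bound (M.measurable_reward p w h).aestronglyMeasurable 1
    (Filter.Eventually.of_forall fun s => by
      rw [Real.norm_of_nonneg (M.r_nonneg _ _ _ _)]; exact M.r_le_one _ _ _ _)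

theorem ContextualMDP.value_of_le {h : ℕ} (hh : H ≤ h) (s : S) : M.value H p h s w = 0 := by
  simp [ContextualMDP.value, Nat.sub_eq_zero_of_le hh]

theorem ContextualMDP.value_nonneg (h : ℕ) (s : S) : 0 ≤ M.value H p h s w :=
  Finset.sum_nonneg fun _ _ => integral_nonneg fun _ => M.r_nonneg _ _ _ _

theorem ContextualMDP.value_le (h : ℕ) (s : S) : M.value H p h s w ≤ (H - h : ℕ) := by
  unfold ContextualMDP.value
  refine (Finset.sum_le_sum (g := fun _ => (1 : ℝ)) fun n _ => ?_).trans (by simp)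
  refine (integral_mono (M.integrable_reward p w (h + n) _) (integrable_const 1)
    fun x => M.r_le_one _ _ _ _).trans ?_
  simp

theorem ContextualMDP.value_le_horizon (h : ℕ) (s : S) : M.value H p h s w ≤ H :=
  (M.value_le H p w h s).trans (by exact_mod_cast Nat.sub_le H h)

theorem ContextualMDP.measurable_integral_reward (n h : ℕ) (h' : ℕ) :
    StronglyMeasurable fun s =>
      ∫ x, M.r h' x (p.act h' (x, w)) w ∂(M.stateLaw p w n h s) :=
  ((M.measurable_reward p w h').comp measurable_snd).stronglyMeasurable.integral_kernel_prod_right'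
    (κ := M.stateLaw p w n h)

/-- The Bellman equation. -/
theorem ContextualMDP.value_eq {h : ℕ} (hh : h < H) (s : S) :
    M.value H p h s w = M.r h s (p.act h (s, w)) w +
      ∫ s', M.value H p (h + 1) s' w ∂(M.P h (s, p.act h (s, w))) := by
  have hsub : H - h = (H - (h + 1)) + 1 := by omega
  have hint : ∀ n (ν : Measure S) [IsFiniteMeasure ν], Integrable (fun s' =>
      ∫ x, M.r (h + 1 + n) x (p.act (h + 1 + n) (x, w)) w ∂(M.stateLaw p w n (h + 1) s')) ν := by
    intro n ν _
    refine Integrable.of_bound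
      (M.measurable_integral_reward p w n (h + 1) (h + 1 + n)).aestronglyMeasurable 1
      (Filter.Eventually.of_forall fun s' => ?_)
    refine (norm_integral_le_of_norm_le_const (C := 1)
      (Filter.Eventually.of_forall fun x => ?_)).trans (by simp)
    rw [Real.norm_of_nonneg (M.r_nonneg _ _ _ _)]; exact M.r_le_one _ _ _ _
  unfold ContextualMDP.value
  -- The term `n = 0` is split off: its state law is a Dirac mass. In the others, the first
  -- transition is integrated last.
  rw [hsub, Finset.sum_range_succ', add_comm, integral_finsetSum _ fun n _ => hint n _]
  congr 1
  · simp only [ContextualMDP.stateLaw, add_zero, Kernel.id_apply]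
    exact integral_dirac' _ _ (M.measurable_reward p w h).stronglyMeasurable
  · refine Finset.sum_congr rfl fun n _ => ?_
    rw [show h + (n + 1) = h + 1 + n by ring, ContextualMDP.stateLaw,
      Kernel.integral_comp (M.integrable_reward p w _ _), ContextualMDP.step, Kernel.comap_apply]

/-- Only upper bounds on the optimal value enter the analysis, so no optimal policy or Bellman
optimality equation is needed. -/
theorem ContextualMDP.optValue_le [Nonempty A] {h : ℕ} {s : S} {b : ℝ}
    (hb : ∀ p : Policy S A W, M.value H p h s w ≤ b) : M.optValue H h s w ≤ b := by
  have : Nonempty (Policy S A W) :=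
    ⟨⟨fun _ _ => Classical.arbitrary A, fun _ => measurable_const⟩⟩
  exact ciSup_le hb

end ValueFunctions

/-! ### Joint measurability of values of random policies. -/

section ParametricMeasurability

variable {S A W α : Type*} [MeasurableSpace S] [MeasurableSpace A] [MeasurableSpace W]
  [MeasurableSpace α] (M : ContextualMDP S A W)

/-- Integrating a jointly measurable function against the transition kernel, in the presence of
parameters. -/
theorem ContextualMDP.measurable_backup (h : ℕ) {g : α → S → ℝ}
    (hg : Measurable fun x : α × S => g x.1 x.2) {st : α → S} {ac : α → A}
    (hst : Measurable st) (hac : Measurable ac) :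
    Measurable fun x => ∫ s', g x s' ∂(M.P h (st x, ac x)) := by
  have := hg.stronglyMeasurable.integral_kernel_prod_right'
    (κ := (M.P h).comap (fun x => (st x, ac x)) (hst.prodMk hac))
  simpa [Kernel.comap_apply] using this.measurable

theorem ContextualMDP.measurable_value (H : ℕ) {π : α → Policy S A W}
    (hπ : ∀ h < H, Measurable fun x : α × (S × W) => (π x.1).act h x.2) (h : ℕ) :
    Measurable fun x : α × (S × W) => M.value H (π x.1) h x.2.1 x.2.2 := by
  induction hn : H - h generalizing h with
  | zero =>
    have : H ≤ h := by omega
    simp only [M.value_of_le H _ _ this]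
    exact measurable_const
  | succ n ih =>
    have hh : h < H := by omega
    have ih' := ih (h + 1) (by omega)
    simp only [M.value_eq H _ _ hh]
    have hact := hπ h hh
    refine Measurable.add ?_ ?_
    · exact (M.measurable_r h).comp (measurable_snd.fst.prodMk (hact.prodMk measurable_snd.snd))
    · refine M.measurable_backup h (α := α × (S × W))
        (g := fun x s' => M.value H (π x.1) (h + 1) s' x.2.2) ?_ measurable_snd.fst hact
      exact ih'.comp (measurable_fst.fst.prodMk (measurable_snd.prodMk measurable_fst.snd.snd))

end ParametricMeasurability

/-! ### Conditional laws, Hoeffding's lemma and exponential supermartingales. -/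

section ConditionalLaw

open scoped ENNReal

variable {S A W α Ω : Type*} [MeasurableSpace S] [MeasurableSpace A] [MeasurableSpace W]
  {mα : MeasurableSpace α} {mΩ : MeasurableSpace Ω} {μ : Measure Ω} [IsProbabilityMeasure μ]

/-- The hypothesis says that the law of `(Z, Y)` and `law(Z) ⊗ κ` agree on rectangles, hence
everywhere. The kernel being given, no regular conditional distribution has to be constructed and
`S` need not be standard Borel. -/
theorem lintegral_eq_of_conditionalLaw {Z : Ω → α} (hZ : Measurable Z) {Y : Ω → S}
    (hY : Measurable Y) (κ : Kernel α S) [IsMarkovKernel κ]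
    (hlaw : ∀ E B, MeasurableSet E → MeasurableSet B →
      μ (Z ⁻¹' E ∩ Y ⁻¹' B) = ∫⁻ ω in Z ⁻¹' E, κ (Z ω) B ∂μ)
    {f : α × S → ℝ≥0∞} (hf : Measurable f) :
    ∫⁻ ω, f (Z ω, Y ω) ∂μ = ∫⁻ ω, ∫⁻ s, f (Z ω, s) ∂(κ (Z ω)) ∂μ := by
  have : IsProbabilityMeasure (μ.map Z) := Measure.isProbabilityMeasure_map hZ.aemeasurable
  have e : μ.map (fun ω => (Z ω, Y ω)) = (μ.map Z) ⊗ₘ κ := by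
    have : IsProbabilityMeasure (μ.map (fun ω => (Z ω, Y ω))) :=
      Measure.isProbabilityMeasure_map (hZ.prodMk hY).aemeasurable
    refine Measure.ext_prod fun {E B} hE hB => ?_
    rw [Measure.map_apply (hZ.prodMk hY) (hE.prod hB), Measure.compProd_apply_prod hE hB,
      setLIntegral_map hE (κ.measurable_coe hB) hZ, ← hlaw E B hE hB]
    rfl
  rw [← lintegral_map (f := f) hf (hZ.prodMk hY), e, Measure.lintegral_compProd hf,
    lintegral_map hf.lintegral_kernel_prod_right' hZ]

theorem conditionalLaw_of_condExp {m : MeasurableSpace Ω} (hm : m ≤ mΩ) {Y : Ω → S}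
    (hY : Measurable[mΩ] Y) (κ : Kernel α S) [IsMarkovKernel κ] {Z : Ω → α} (hZ : Measurable[m] Z)
    {B : Set S} (hB : MeasurableSet B)
    (h : μ[(Y ⁻¹' B).indicator (fun _ => (1 : ℝ)) | m] =ᵐ[μ] fun ω => (κ (Z ω)).real B)
    {E : Set Ω} (hE : MeasurableSet[m] E) :
    μ (E ∩ Y ⁻¹' B) = ∫⁻ ω in E, κ (Z ω) B ∂μ := by
  have hi : Integrable ((Y ⁻¹' B).indicator (fun _ => (1 : ℝ))) μ :=
    (integrable_const 1).indicator (hY hB)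
  have h1 := setIntegral_condExp hm hi hE
  rw [setIntegral_congr_ae (hm _ hE) (h.mono fun ω hω _ => hω),
    integral_indicator (hY hB), Measure.restrict_restrict (hY hB)] at h1
  simp only [integral_const, smul_eq_mul, mul_one, measureReal_restrict_apply_univ] at h1
  have hmeas : Measurable[mΩ] fun ω => (κ (Z ω)).real B :=
    ((κ.measurable_coe hB).comp (hZ.mono hm le_rfl)).ennreal_toReal
  have h2 : ENNReal.ofReal (∫ ω in E, (κ (Z ω)).real B ∂μ) = ∫⁻ ω in E, κ (Z ω) B ∂μ := by
    rw [ofReal_integral_eq_lintegral_ofReal]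
    · refine lintegral_congr fun ω => ?_
      exact ENNReal.ofReal_toReal (measure_ne_top _ _)
    · exact Integrable.of_bound hmeas.aestronglyMeasurable 1 (Filter.Eventually.of_forall fun ω => by
        rw [Real.norm_of_nonneg measureReal_nonneg]; exact measureReal_le_one)
    · exact Filter.Eventually.of_forall fun ω => measureReal_nonneg
  rw [← h2, h1, Set.inter_comm E]
  exact (ENNReal.ofReal_toReal (measure_ne_top _ _)).symm

/-- Hoeffding's lemma. -/
theorem lintegral_exp_sub_integral_le {ν : Measure S} [IsProbabilityMeasure ν] {g : S → ℝ}
    (hg : Measurable g) {a ℓ : ℝ} (hb : ∀ s, g s ∈ Set.Icc a (a + ℓ)) :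
    ∫⁻ s, ENNReal.ofReal (Real.exp (g s - ∫ x, g x ∂ν - ℓ ^ 2 / 8)) ∂ν ≤ 1 := by
  have hsub := hasSubgaussianMGF_of_mem_Icc (μ := ν) hg.aemeasurable
    (Filter.Eventually.of_forall hb)
  have h1 := hsub.mgf_le 1
  have h2 := hsub.integrable_exp_mul 1
  have hc : (((‖a + ℓ - a‖₊ / 2) ^ 2 : NNReal) : ℝ) * 1 ^ 2 / 2 = ℓ ^ 2 / 8 := by
    push_cast
    rw [add_sub_cancel_left, div_pow, Real.norm_eq_abs, sq_abs]
    ring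
  rw [hc, mgf] at h1
  simp only [one_mul] at h1 h2
  simp only [Real.exp_sub _ (ℓ ^ 2 / 8)]
  rw [← ofReal_integral_eq_lintegral_ofReal (h2.div_const _)
    (Filter.Eventually.of_forall fun s => by positivity), integral_div, ENNReal.ofReal_le_one]
  exact div_le_one_of_le₀ h1 (Real.exp_pos _).le

/-- The arbitrary weight `F` of the past expresses that the compensated exponential has conditional
mean at most 1, without mentioning conditional expectations. The range `[a, a + ℓ]` may itself
depend on the past. -/
theorem lintegral_mul_exp_increment_le {Z : Ω → α} (hZ : Measurable Z) {Y : Ω → S}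
    (hY : Measurable Y) (κ : Kernel α S) [IsMarkovKernel κ]
    (hlaw : ∀ E B, MeasurableSet E → MeasurableSet B →
      μ (Z ⁻¹' E ∩ Y ⁻¹' B) = ∫⁻ ω in Z ⁻¹' E, κ (Z ω) B ∂μ)
    {g : α → S → ℝ} (hg : Measurable fun x : α × S => g x.1 x.2) {a ℓ : α → ℝ} (hℓ : Measurable ℓ)
    (hb : ∀ z s, g z s ∈ Set.Icc (a z) (a z + ℓ z)) {F : α → ℝ≥0∞} (hF : Measurable F) :
    ∫⁻ ω, F (Z ω) * ENNReal.ofReal (Real.exp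
      (g (Z ω) (Y ω) - ∫ x, g (Z ω) x ∂(κ (Z ω)) - ℓ (Z ω) ^ 2 / 8)) ∂μ ≤ ∫⁻ ω, F (Z ω) ∂μ := by
  have hi : Measurable fun z => ∫ x, g z x ∂(κ z) :=
    (hg.stronglyMeasurable.integral_kernel_prod_right' (κ := κ)).measurable
  have hf : Measurable fun x : α × S => ENNReal.ofReal (Real.exp
      (g x.1 x.2 - ∫ y, g x.1 y ∂(κ x.1) - ℓ x.1 ^ 2 / 8)) :=
    (Real.measurable_exp.comp ((hg.sub (hi.comp measurable_fst)).sub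
      (((hℓ.comp measurable_fst).pow_const 2).div_const 8))).ennreal_ofReal
  rw [lintegral_eq_of_conditionalLaw hZ hY κ hlaw
    (f := fun x => F x.1 * ENNReal.ofReal (Real.exp
      (g x.1 x.2 - ∫ y, g x.1 y ∂(κ x.1) - ℓ x.1 ^ 2 / 8)))
    ((hF.comp measurable_fst).mul hf)]
  refine lintegral_mono fun ω => ?_
  dsimp only
  have hf' : Measurable fun s => ENNReal.ofReal (Real.exp
      (g (Z ω) s - ∫ y, g (Z ω) y ∂(κ (Z ω)) - ℓ (Z ω) ^ 2 / 8)) := hf.comp measurable_prodMk_left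
  rw [lintegral_const_mul _ hf']
  exact mul_le_of_le_one_right' (lintegral_exp_sub_integral_le (hg.comp measurable_prodMk_left)
    (hb (Z ω)))

/-- Chernoff's bound for a process whose exponential is a supermartingale. -/
theorem measure_sum_ge_le_exp_neg (G : ℕ → MeasurableSpace Ω) (N : ℕ) (X : ℕ → Ω → ℝ) (hX : ∀ i < N, ∀ j < i, Measurable[G i] (X j))
    (hX' : ∀ i < N, Measurable (X i))
    (hsup : ∀ i < N, ∀ F : Ω → ℝ≥0∞, Measurable[G i] F →
      ∫⁻ ω, F ω * ENNReal.ofReal (Real.exp (X i ω)) ∂μ ≤ ∫⁻ ω, F ω ∂μ) (L : ℝ) :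
    μ {ω | L ≤ ∑ i ∈ Finset.range N, X i ω} ≤ ENNReal.ofReal (Real.exp (-L)) := by
  have key : ∀ n ≤ N, ∫⁻ ω, ENNReal.ofReal (Real.exp (∑ i ∈ Finset.range n, X i ω)) ∂μ ≤ 1 := by
    intro n hn
    induction n with
    | zero => simp
    | succ n ih =>
      refine le_trans ?_ (ih (by omega))
      have e : ∀ ω, ENNReal.ofReal (Real.exp (∑ i ∈ Finset.range (n + 1), X i ω)) =
          ENNReal.ofReal (Real.exp (∑ i ∈ Finset.range n, X i ω)) *
            ENNReal.ofReal (Real.exp (X n ω)) := fun ω => by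
        rw [Finset.sum_range_succ, Real.exp_add, ENNReal.ofReal_mul (Real.exp_pos _).le]
      simp only [e]
      refine hsup n (by omega) _ ?_
      refine (Real.measurable_exp.comp ?_).ennreal_ofReal
      exact Finset.measurable_fun_sum _ fun j hj =>
        hX n (by omega) j (Finset.mem_range.1 hj)
  have hm : Measurable fun ω => ENNReal.ofReal (Real.exp (∑ i ∈ Finset.range N, X i ω)) :=
    (Real.measurable_exp.comp (Finset.measurable_fun_sum _ fun j hj =>
      hX' j (Finset.mem_range.1 hj))).ennreal_ofReal
  have h1 := (mul_meas_ge_le_lintegral (μ := μ) hm (ENNReal.ofReal (Real.exp L))).trans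
    (key N le_rfl)
  have hset : {ω | ENNReal.ofReal (Real.exp L) ≤
      ENNReal.ofReal (Real.exp (∑ i ∈ Finset.range N, X i ω))} =
      {ω | L ≤ ∑ i ∈ Finset.range N, X i ω} := by
    ext ω
    simp only [Set.mem_ofPred_eq]
    rw [ENNReal.ofReal_le_ofReal_iff (Real.exp_pos _).le, Real.exp_le_exp]
  rw [hset] at h1
  have hpos : ENNReal.ofReal (Real.exp L) ≠ 0 := by simpa using Real.exp_pos L
  rw [Real.exp_neg, ENNReal.ofReal_inv_of_pos (Real.exp_pos _)]
  rwa [ENNReal.le_inv_iff_mul_le, mul_comm]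

end ConditionalLaw

/-! ### Measurability of matrix operations and of the algorithm. -/

section MatrixMeasurability

open Matrix

variable {α : Type*} [MeasurableSpace α] {d : ℕ}

theorem measurable_matrix_det {B : α → Matrix (Fin d) (Fin d) ℝ}
    (hB : ∀ i j, Measurable fun x => B x i j) : Measurable fun x => (B x).det := by
  simp only [det_apply']
  exact Finset.measurable_fun_sum _ fun σ _ =>
    (Finset.measurable_fun_prod _ fun i _ => hB _ _).const_mul _

/-- Cramer's rule gives the entries; it also covers singular matrices, whose inverse is zero by
convention. -/
theorem measurable_matrix_inv {B : α → Matrix (Fin d) (Fin d) ℝ}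
    (hB : ∀ i j, Measurable fun x => B x i j) (i j : Fin d) :
    Measurable fun x => (B x)⁻¹ i j := by
  simp only [inv_def, Matrix.smul_apply, smul_eq_mul, Ring.inverse_eq_inv', adjugate_apply]
  refine (measurable_matrix_det hB).inv.mul (measurable_matrix_det fun i' j' => ?_)
  rw [show (fun x => (B x).updateRow j (Pi.single i 1) i' j') = fun x =>
    if i' = j then (Pi.single i 1 : Fin d → ℝ) j' else B x i' j' from
      funext fun x => updateRow_apply]
  split_ifs
  · exact measurable_const
  · exact hB _ _

theorem measurable_dotProduct {u v : α → Fin d → ℝ} (hu : ∀ i, Measurable fun x => u x i)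
    (hv : ∀ i, Measurable fun x => v x i) : Measurable fun x => u x ⬝ᵥ v x :=
  Finset.measurable_fun_sum _ fun i _ => (hu i).mul (hv i)

theorem measurable_mulVec {B : α → Matrix (Fin d) (Fin d) ℝ} {v : α → Fin d → ℝ}
    (hB : ∀ i j, Measurable fun x => B x i j) (hv : ∀ i, Measurable fun x => v x i) (i : Fin d) :
    Measurable fun x => (B x *ᵥ v x) i :=
  measurable_dotProduct (hB i) hv

theorem measurable_coord {u : α → EuclideanSpace ℝ (Fin d)} (hu : Measurable u) (i : Fin d) :
    Measurable fun x => (u x).ofLp i :=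
  (show Continuous fun y : EuclideanSpace ℝ (Fin d) => y.ofLp i by fun_prop).measurable.comp hu

theorem measurable_wnorm {B : α → Matrix (Fin d) (Fin d) ℝ} {v : α → EuclideanSpace ℝ (Fin d)}
    (hB : ∀ i j, Measurable fun x => B x i j) (hv : Measurable v) :
    Measurable fun x => wnorm (B x) (v x) :=
  (measurable_dotProduct (measurable_coord hv) (measurable_mulVec hB (measurable_coord hv))).sqrt

theorem measurable_maxAct {A : Type*} [Fintype A] [Nonempty A] {f : α → A → ℝ}
    (hf : ∀ a, Measurable fun x => f x a) : Measurable fun x => maxAct (f x) := by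
  have := Finset.measurable_sup' (s := (Finset.univ : Finset A)) Finset.univ_nonempty
    (f := fun a x => f x a) fun a _ => hf a
  convert this using 1
  ext x
  simp [maxAct]

end MatrixMeasurability

section AlgorithmFunctions

variable {S A W : Type*} {d H k : ℕ} {ψ : S → A → W → EuclideanSpace ℝ (Fin d)} {lam : ℝ}
  [Fintype A] [Nonempty A]

/-- The truncated value function `min {max_a Q_h^k, H}` of the algorithm. -/
def Vfun (r : ℕ → S → A → W → ℝ) (H : ℕ) (ψ : S → A → W → EuclideanSpace ℝ (Fin d))
    (lam β : ℝ) (D : Log S A W) (k h : ℕ) (s : S) (w : W) : ℝ :=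
  min (maxAct fun a => Qfun r H ψ lam β D k h s a w) (H : ℝ)

/-- The least-squares parameter `ν_h^k` of the algorithm. -/
def lsqParam (r : ℕ → S → A → W → ℝ) (H : ℕ) (ψ : S → A → W → EuclideanSpace ℝ (Fin d))
    (lam β : ℝ) (D : Log S A W) (k h : ℕ) : EuclideanSpace ℝ (Fin d) :=
  WithLp.toLp 2 ((LifelongRL.gram ψ lam D h k)⁻¹.mulVec
    (∑ τ ∈ Finset.range k, Vfun r H ψ lam β D k (h + 1) (D.state τ (h + 1)) (D.ctx τ) •
      (D.feature ψ h τ).ofLp))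

theorem Qfun_of_lt {r : ℕ → S → A → W → ℝ} {β : ℝ} {D : Log S A W} {h : ℕ} (hh : h < H) (s : S)
    (a : A) (w : W) : Qfun r H ψ lam β D k h s a w =
      max (r h s a w + inner ℝ (lsqParam r H ψ lam β D k h) (ψ s a w) +
        β * wnorm (LifelongRL.gram ψ lam D h k)⁻¹ (ψ s a w)) 0 := by
  rw [Qfun, dif_pos hh]
  rfl

theorem Qfun_of_le {r : ℕ → S → A → W → ℝ} {β : ℝ} {D : Log S A W} {h : ℕ} (hh : H ≤ h) (s : S)
    (a : A) (w : W) : Qfun r H ψ lam β D k h s a w = 0 := by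
  rw [Qfun, dif_neg (by omega)]

theorem Qfun_nonneg {r : ℕ → S → A → W → ℝ} {β : ℝ} {D : Log S A W} {h : ℕ} (s : S)
    (a : A) (w : W) : 0 ≤ Qfun r H ψ lam β D k h s a w := by
  rcases lt_or_ge h H with hh | hh
  · rw [Qfun_of_lt hh]; exact le_max_right _ _
  · rw [Qfun_of_le hh]

end AlgorithmFunctions

section AlgorithmMeasurability

variable {S A W α : Type*} [MeasurableSpace S] [MeasurableSpace A] [MeasurableSpace W]
  [MeasurableSpace α] {d : ℕ}

/-- The data of the episodes before episode `k` depend measurably on a parameter. -/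
structure MeasurableLog (D : α → Log S A W) (H k : ℕ) : Prop where
  state : ∀ τ < k, ∀ h ≤ H, Measurable fun x => (D x).state τ h
  action : ∀ τ < k, ∀ h < H, Measurable fun x => (D x).action τ h
  ctx : ∀ τ < k, Measurable fun x => (D x).ctx τ

variable {D : α → Log S A W} {H k : ℕ} {ψ : S → A → W → EuclideanSpace ℝ (Fin d)} {lam : ℝ}

theorem MeasurableLog.feature (hD : MeasurableLog D H k)
    (hψ : Measurable fun x : S × A × W => ψ x.1 x.2.1 x.2.2) {τ h : ℕ} (hτ : τ < k) (hh : h < H) :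
    Measurable fun x => (D x).feature ψ h τ :=
  hψ.comp ((hD.state τ hτ h hh.le).prodMk ((hD.action τ hτ h hh).prodMk (hD.ctx τ hτ)))

theorem MeasurableLog.gram (hD : MeasurableLog D H k)
    (hψ : Measurable fun x : S × A × W => ψ x.1 x.2.1 x.2.2) {j h : ℕ} (hj : j ≤ k) (hh : h < H)
    (i i' : Fin d) : Measurable fun x => LifelongRL.gram ψ lam (D x) h j i i' := by
  simp only [LifelongRL.gram, Matrix.add_apply, Matrix.sum_apply, Matrix.vecMulVec_apply]
  refine measurable_const.add (Finset.measurable_fun_sum _ fun τ hτ => ?_)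
  have := hD.feature hψ ((Finset.mem_range.1 hτ).trans_le hj) hh
  exact (measurable_coord this i).mul (measurable_coord this i')

theorem MeasurableLog.replan (hD : MeasurableLog D H k)
    (hψ : Measurable fun x : S × A × W => ψ x.1 x.2.1 x.2.2) {j j' : ℕ} (hj : j ≤ k)
    (hj' : j' ≤ k) : MeasurableSet {x | Replan H ψ lam (D x) j j'} := by
  have : {x | Replan H ψ lam (D x) j j'} = ⋃ h ∈ Set.Iio H, {x | Real.exp 1 <
      (LifelongRL.gram ψ lam (D x) h j).det / (LifelongRL.gram ψ lam (D x) h j').det} := by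
    ext x; simp [Replan]
  rw [this]
  refine MeasurableSet.biUnion (Set.to_countable _) fun h hh => ?_
  exact measurableSet_lt measurable_const ((measurable_matrix_det (hD.gram hψ hj hh)).div
    (measurable_matrix_det (hD.gram hψ hj' hh)))

/-- The index `k + 1` is allowed: the test of episode `k` involves Gram matrices of index at most
`k`, which use only episodes before `k`. -/
theorem MeasurableLog.planBefore (hD : MeasurableLog D H k)
    (hψ : Measurable fun x : S × A × W => ψ x.1 x.2.1 x.2.2) {j : ℕ} (hj : j ≤ k + 1) :
    Measurable fun x => LifelongRL.planBefore H ψ lam (D x) j := by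
  induction j with
  | zero => exact measurable_const
  | succ j ih =>
    have ih := ih (by omega)
    simp only [LifelongRL.planBefore]
    refine Measurable.ite ?_ measurable_const ih
    have : {x | Replan H ψ lam (D x) j (LifelongRL.planBefore H ψ lam (D x) j)} =
        ⋃ i ∈ Set.Iic j, ({x | LifelongRL.planBefore H ψ lam (D x) j = i} ∩
          {x | Replan H ψ lam (D x) j i}) := by
      ext x
      simp only [Set.mem_ofPred_eq, Set.mem_iUnion, Set.mem_inter_iff, exists_prop, Set.mem_Iic]
      exact ⟨fun h => ⟨_, planBefore_le ψ (D x) H j, rfl, h⟩, fun ⟨i, _, h1, h2⟩ => h1 ▸ h2⟩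
    rw [this]
    refine MeasurableSet.biUnion (Set.to_countable _) fun i hi => ?_
    exact (ih (measurableSet_singleton i)).inter
      (hD.replan hψ (by omega) (le_trans (Set.mem_Iic.1 hi) (by omega)))

theorem MeasurableLog.planUsed (hD : MeasurableLog D H k)
    (hψ : Measurable fun x : S × A × W => ψ x.1 x.2.1 x.2.2) :
    Measurable fun x => LifelongRL.planUsed H ψ lam (D x) k :=
  hD.planBefore hψ le_rfl

variable [Fintype A] [Nonempty A]

theorem MeasurableLog.Qfun (hD : MeasurableLog D H k)
    (hψ : Measurable fun x : S × A × W => ψ x.1 x.2.1 x.2.2) {r : ℕ → S → A → W → ℝ}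
    (hr : ∀ h, Measurable fun x : S × A × W => r h x.1 x.2.1 x.2.2) (β : ℝ) {j : ℕ} (hj : j ≤ k)
    (h : ℕ) : Measurable fun x : α × (S × A × W) =>
      LifelongRL.Qfun r H ψ lam β (D x.1) j h x.2.1 x.2.2.1 x.2.2.2 := by
  induction hn : H - h generalizing h with
  | zero =>
    simp only [Qfun_of_le (show H ≤ h by omega)]
    exact measurable_const
  | succ n ih =>
    have hh : h < H := by omega
    have ih' := ih (h + 1) (by omega)
    simp only [Qfun_of_lt hh]
    have hψ' : Measurable fun x : α × (S × A × W) => ψ x.2.1 x.2.2.1 x.2.2.2 :=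
      hψ.comp measurable_snd
    have hG : ∀ i i', Measurable fun x : α × (S × A × W) =>
        (LifelongRL.gram ψ lam (D x.1) h j)⁻¹ i i' := fun i i' =>
      measurable_matrix_inv (fun i i' => (hD.gram hψ hj hh i i').comp measurable_fst) i i'
    refine (Measurable.add (((hr h).comp measurable_snd).add ?_)
      ((measurable_wnorm hG hψ').const_mul β)).max measurable_const
    simp only [inner_eq_dotProduct]
    refine measurable_dotProduct (fun i => measurable_mulVec hG (fun i => ?_) i)
      (measurable_coord hψ')
    simp only [Finset.sum_apply, Pi.smul_apply, smul_eq_mul]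
    refine Finset.measurable_fun_sum _ fun τ hτ => ?_
    have hτ' : τ < k := (Finset.mem_range.1 hτ).trans_le hj
    refine Measurable.mul ?_ ((measurable_coord (hD.feature hψ hτ' hh) i).comp measurable_fst)
    refine (measurable_maxAct fun a => ?_).min measurable_const
    exact ih'.comp (measurable_fst.prodMk (((hD.state τ hτ' (h + 1) hh).comp measurable_fst).prodMk
      (measurable_const.prodMk ((hD.ctx τ hτ').comp measurable_fst))))

theorem MeasurableLog.Vfun_planUsed (hD : MeasurableLog D H k)
    (hψ : Measurable fun x : S × A × W => ψ x.1 x.2.1 x.2.2) {r : ℕ → S → A → W → ℝ}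
    (hr : ∀ h, Measurable fun x : S × A × W => r h x.1 x.2.1 x.2.2) (β : ℝ) (h : ℕ) :
    Measurable fun x : α × (S × W) =>
      Vfun r H ψ lam β (D x.1) (LifelongRL.planUsed H ψ lam (D x.1) k) h x.2.1 x.2.2 := by
  -- The plan index takes countably many values, so it suffices to treat each one. Capping it at `k`
  -- makes the function measurable for every natural number, and the cap is inactive at the true
  -- index.
  have h1 : Measurable fun y : (α × (S × W)) × ℕ =>
      Vfun r H ψ lam β (D y.1.1) (min y.2 k) h y.1.2.1 y.1.2.2 := by
    refine measurable_from_prod_countable_left fun n => ?_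
    refine (measurable_maxAct fun a => ?_).min measurable_const
    exact (hD.Qfun hψ hr β (min_le_right n k) h).comp (measurable_fst.prodMk
      (measurable_snd.fst.prodMk (measurable_const.prodMk measurable_snd.snd)))
  have h2 := h1.comp (measurable_id.prodMk ((hD.planUsed (lam := lam) hψ).comp measurable_fst))
  convert h2 using 1
  ext x
  simp only [Function.comp_apply, id_eq, min_eq_left (planUsed_le ψ (D x.1) H k)]

end AlgorithmMeasurability

/-! ### Supermartingales generated by the interaction. -/

section InteractionIncrements

open scoped ENNReal

variable {S A W Ω : Type*} [MeasurableSpace S] [MeasurableSpace A] [MeasurableSpace W]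
  {mΩ : MeasurableSpace Ω} {M : ContextualMDP S A W} {H K : ℕ} {μ : Measure Ω}

theorem clock_mono {H k h k' h' : ℕ} (hk : k < k') (hh : h ≤ H + 1) :
    clock H k h ≤ clock H k' h' := by
  unfold clock
  have : (k + 1) * (H + 1) ≤ k' * (H + 1) := Nat.mul_le_mul_right _ hk
  nlinarith

theorem clock_zero_le (H k h : ℕ) : clock H k 0 ≤ clock H k h := by simp [clock]

theorem Interaction.measurable_ctx_clock (I : Interaction M H K μ) {k : ℕ} (hk : k < K) (h : ℕ) :
    Measurable[I.filt (clock H k h)] (I.ctx k) :=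
  (I.measurable_ctx k hk).mono (I.filt.mono (clock_zero_le H k h)) le_rfl

theorem Interaction.measurable_action (I : Interaction M H K μ) {k h : ℕ} (hk : k < K)
    (hh : h < H) : Measurable[I.filt (clock H k h)] fun ω => (I.log ω).action k h := by
  have h1 := I.measurable_policy k hk h hh
  have h2 : Measurable[I.filt (clock H k h), (I.filt (clock H k 0)).prod
      (inferInstance : MeasurableSpace (S × W))] fun ω => (ω, (I.state k h ω, I.ctx k ω)) :=
    (measurable_id.mono (I.filt.mono (clock_zero_le H k h)) le_rfl).prodMk
      ((I.measurable_state k hk h hh.le).prodMk (I.measurable_ctx_clock hk h))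
  exact h1.comp h2

theorem Interaction.measurableLog (I : Interaction M H K μ) {k : ℕ} (hk : k ≤ K) :
    @MeasurableLog S A W Ω _ _ _ (I.filt (clock H k 0)) I.log H k := by
  refine @MeasurableLog.mk S A W Ω _ _ _ (I.filt (clock H k 0)) I.log H k ?_ ?_ ?_
  · exact fun τ hτ h hh => (I.measurable_state τ (by omega) h hh).mono
      (I.filt.mono (clock_mono hτ (by omega))) le_rfl
  · exact fun τ hτ h hh => (I.measurable_action (by omega : τ < K) hh).mono
      (I.filt.mono (clock_mono hτ (by omega))) le_rfl
  · exact fun τ hτ => (I.measurable_ctx τ (by omega)).mono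
      (I.filt.mono (clock_mono hτ (by omega))) le_rfl

/-- The increment `g(s_{h+1}^k) - P_h[g](s_h^k, a_h^k)` of a (random) function. -/
def increment (M : ContextualMDP S A W) (D : Log S A W) (k h : ℕ) (g : S → ℝ) : ℝ :=
  g (D.state k (h + 1)) - ∫ s', g s' ∂(M.P h (D.state k h, D.action k h))

theorem Interaction.measurable_increment (I : Interaction M H K μ) {k h : ℕ} (hk : k < K)
    (hh : h < H) {g : Ω → S → ℝ}
    (hg : Measurable[(I.filt (clock H k h)).prod (inferInstance : MeasurableSpace S)]
      fun x : Ω × S => g x.1 x.2) :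
    Measurable[I.filt (clock H k (h + 1))] fun ω => increment M (I.log ω) k h (g ω) := by
  have hle : I.filt (clock H k h) ≤ I.filt (clock H k (h + 1)) :=
    I.filt.mono (by simp [clock])
  have h1 : Measurable[I.filt (clock H k h)] fun ω =>
      ∫ s', g ω s' ∂(M.P h ((I.log ω).state k h, (I.log ω).action k h)) :=
    @ContextualMDP.measurable_backup S A W Ω _ _ _ (I.filt (clock H k h)) M h g hg _ _
      (I.measurable_state k hk h hh.le) (I.measurable_action hk hh)
  have h2 : Measurable[I.filt (clock H k (h + 1)),
      (I.filt (clock H k h)).prod (inferInstance : MeasurableSpace S)]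
      fun ω => (ω, I.state k (h + 1) ω) :=
    (measurable_id.mono hle le_rfl).prodMk (I.measurable_state k hk (h + 1) hh)
  exact (hg.comp h2).sub (h1.mono hle le_rfl)

theorem Interaction.lintegral_exp_increment_le [IsProbabilityMeasure μ] (I : Interaction M H K μ)
    {k h : ℕ} (hk : k < K) (hh : h < H) {g : Ω → S → ℝ}
    (hg : Measurable[(I.filt (clock H k h)).prod (inferInstance : MeasurableSpace S)]
      fun x : Ω × S => g x.1 x.2)
    {a ℓ : Ω → ℝ} (hℓ : Measurable[I.filt (clock H k h)] ℓ)
    (hb : ∀ ω s, g ω s ∈ Set.Icc (a ω) (a ω + ℓ ω)) {F : Ω → ℝ≥0∞}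
    (hF : Measurable[I.filt (clock H k h)] F) :
    ∫⁻ ω, F ω * ENNReal.ofReal (Real.exp (increment M (I.log ω) k h (g ω) - ℓ ω ^ 2 / 8)) ∂μ ≤
      ∫⁻ ω, F ω ∂μ := by
  have hm := I.filt.le (clock H k h)
  have hY : Measurable (I.state k (h + 1)) :=
    (I.measurable_state k hk (h + 1) hh).mono (I.filt.le _) le_rfl
  have hsa : Measurable[I.filt (clock H k h)] fun ω => (I.state k h ω, (I.log ω).action k h) :=
    (I.measurable_state k hk h hh.le).prodMk (I.measurable_action hk hh)
  let κ : @Kernel Ω S (I.filt (clock H k h)) _ :=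
    Kernel.comap (M.P h) _ hsa
  have hκ : @IsMarkovKernel Ω S (I.filt (clock H k h)) _ κ :=
    Kernel.IsMarkovKernel.comap (M.P h) hsa
  -- The past is encoded by the identity map into `Ω` with the smaller σ-algebra, so that functions
  -- of the past are exactly the functions measurable for it.
  have hZ : Measurable[mΩ, I.filt (clock H k h)] (id : Ω → Ω) := measurable_id.mono hm le_rfl
  refine @lintegral_mul_exp_increment_le S Ω Ω _ (I.filt (clock H k h)) mΩ μ _ id hZ
    (I.state k (h + 1)) hY κ hκ ?_ g hg a ℓ hℓ hb F hF
  intro E B hE hB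
  exact conditionalLaw_of_condExp hm hY (M.P h) hsa hB (I.transition k hk h hh B hB) hE

/-- Concentration for a fixed direction `x` and a fixed function `f`. -/
theorem Interaction.measure_dotProduct_ge_le [IsProbabilityMeasure μ] (I : Interaction M H K μ)
    {d : ℕ} {ψ : S → A → W → EuclideanSpace ℝ (Fin d)}
    (hψ : Measurable fun x : S × A × W => ψ x.1 x.2.1 x.2.2) {f : S → W → ℝ}
    (hf : Measurable fun x : S × W => f x.1 x.2) (hb : ∀ s w, f s w ∈ Set.Icc (0 : ℝ) H)
    (x : EuclideanSpace ℝ (Fin d)) {h k : ℕ} (hh : h < H) (hk : k ≤ K) (L : ℝ) :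
    μ {ω | L ≤ ∑ τ ∈ Finset.range k,
      (inner ℝ x ((I.log ω).feature ψ h τ) *
          increment M (I.log ω) τ h (fun s => f s ((I.log ω).ctx τ)) -
        (inner ℝ x ((I.log ω).feature ψ h τ) * H) ^ 2 / 8)} ≤ ENNReal.ofReal (Real.exp (-L)) := by
  have hfeat : ∀ τ < k, Measurable[I.filt (clock H τ h)] fun ω =>
      inner ℝ x ((I.log ω).feature ψ h τ) := fun τ hτ => by
    have h1 : Measurable[I.filt (clock H τ h)] fun ω => (I.log ω).feature ψ h τ :=
      hψ.comp ((I.measurable_state τ (by omega) h hh.le).prodMk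
        ((I.measurable_action (by omega : τ < K) hh).prodMk
          (I.measurable_ctx_clock (by omega : τ < K) h)))
    exact (show Continuous fun y : EuclideanSpace ℝ (Fin d) => inner ℝ x y by
      fun_prop).measurable.comp h1
  have hg : ∀ τ < k, Measurable[(I.filt (clock H τ h)).prod (inferInstance : MeasurableSpace S)]
      fun y : Ω × S => inner ℝ x ((I.log y.1).feature ψ h τ) * f y.2 ((I.log y.1).ctx τ) :=
    fun τ hτ =>
      letI := I.filt (clock H τ h)
      ((hfeat τ hτ).comp measurable_fst).mul (hf.comp (measurable_snd.prodMk
        ((I.measurable_ctx_clock (by omega : τ < K) h).comp measurable_fst)))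
  have hinc : ∀ τ ω, inner ℝ x ((I.log ω).feature ψ h τ) *
      increment M (I.log ω) τ h (fun s => f s ((I.log ω).ctx τ)) = increment M (I.log ω) τ h
        (fun s => inner ℝ x ((I.log ω).feature ψ h τ) * f s ((I.log ω).ctx τ)) := fun τ ω => by
    simp only [increment, integral_const_mul, mul_sub]
  have habs : ∀ τ ω, (inner ℝ x ((I.log ω).feature ψ h τ) * (H : ℝ)) ^ 2 / 8 =
      (|inner ℝ x ((I.log ω).feature ψ h τ)| * (H : ℝ)) ^ 2 / 8 := fun τ ω => by
    rw [mul_pow, mul_pow, sq_abs]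
  simp only [hinc, habs]
  have hlen : ∀ τ < k, Measurable[I.filt (clock H τ h)] fun ω =>
      |inner ℝ x ((I.log ω).feature ψ h τ)| * (H : ℝ) := fun τ hτ =>
    letI := I.filt (clock H τ h)
    (continuous_abs.measurable.comp (hfeat τ hτ)).mul_const _
  have hmeas : ∀ τ < k, Measurable[I.filt (clock H τ (h + 1))] fun ω => increment M (I.log ω) τ h
      (fun s => inner ℝ x ((I.log ω).feature ψ h τ) * f s ((I.log ω).ctx τ)) -
        (|inner ℝ x ((I.log ω).feature ψ h τ)| * (H : ℝ)) ^ 2 / 8 := fun τ hτ =>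
    (I.measurable_increment (by omega) hh (hg τ hτ)).sub
      ((((hlen τ hτ).mono (I.filt.mono (by simp [clock])) le_rfl).pow_const 2).div_const 8)
  refine measure_sum_ge_le_exp_neg (fun τ => I.filt (clock H τ h)) k _ (fun i hi j hj => ?_)
    (fun i hi => (hmeas i hi).mono (I.filt.le _) le_rfl) (fun i hi F hF => ?_) L
  · exact (hmeas j (hj.trans hi)).mono (I.filt.mono (clock_mono hj (by omega))) le_rfl
  · refine I.lintegral_exp_increment_le (by omega) hh (hg i hi)
      -- The product `c f` with `0 ≤ f ≤ H` lies between `min 0 (cH)` and that value plus `|c| H`,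
      -- for either sign of `c`.
      (a := fun ω => min 0 (inner ℝ x ((I.log ω).feature ψ h i) * H)) (hlen i hi)
      (fun ω s => ?_) hF
    obtain ⟨h0, h1⟩ := hb s ((I.log ω).ctx i)
    have hH : (0 : ℝ) ≤ H := Nat.cast_nonneg H
    generalize inner ℝ x ((I.log ω).feature ψ h i) = c
    rcases le_total 0 c with hc | hc
    · rw [abs_of_nonneg hc, min_eq_left (mul_nonneg hc hH), zero_add]
      exact ⟨mul_nonneg hc h0, mul_le_mul_of_nonneg_left h1 hc⟩
    · rw [abs_of_nonpos hc, min_eq_right (mul_nonpos_of_nonpos_of_nonneg hc hH)]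
      constructor <;> nlinarith

end InteractionIncrements

/-! ### The function class and its dependence on the parameters. -/

section FunctionClass

open Matrix

variable {S A W : Type*} {d : ℕ} [Fintype A] [Nonempty A]

theorem maxAct_le_iff {f : A → ℝ} {b : ℝ} : maxAct f ≤ b ↔ ∀ a, f a ≤ b := by
  simp [maxAct, Finset.sup'_le_iff]

theorem le_maxAct (f : A → ℝ) (a : A) : f a ≤ maxAct f :=
  Finset.le_sup' f (Finset.mem_univ a)

theorem maxAct_nonneg {f : A → ℝ} (h : ∀ a, 0 ≤ f a) : 0 ≤ maxAct f :=
  (h (Classical.arbitrary A)).trans (le_maxAct f _)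

theorem maxAct_le_add {f g : A → ℝ} {δ : ℝ} (h : ∀ a, f a ≤ g a + δ) :
    maxAct f ≤ maxAct g + δ :=
  maxAct_le_iff.2 fun a => (h a).trans (by linarith [le_maxAct g a])

/-- The function `min {max_a {⟨ν, ψ⟩ + β ‖ψ‖_B}⁺, H}`. -/
def classFun (H : ℕ) (ψ : S → A → W → EuclideanSpace ℝ (Fin d)) (β : ℝ)
    (ν : EuclideanSpace ℝ (Fin d)) (B : Matrix (Fin d) (Fin d) ℝ) (s : S) (w : W) : ℝ :=
  min (maxAct fun a => max (inner ℝ ν (ψ s a w) + β * wnorm B (ψ s a w)) 0) (H : ℝ)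

variable {H : ℕ} {ψ : S → A → W → EuclideanSpace ℝ (Fin d)} {β : ℝ}
  {ν : EuclideanSpace ℝ (Fin d)} {B : Matrix (Fin d) (Fin d) ℝ}

theorem classFun_mem_Icc (s : S) (w : W) : classFun H ψ β ν B s w ∈ Set.Icc (0 : ℝ) H :=
  ⟨le_min (maxAct_nonneg fun _ => le_max_right _ _) (Nat.cast_nonneg H),
    min_le_right _ _⟩

theorem measurable_classFun [MeasurableSpace S] [MeasurableSpace A] [MeasurableSpace W]
    (hψ : Measurable fun x : S × A × W => ψ x.1 x.2.1 x.2.2) :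
    Measurable fun x : S × W => classFun H ψ β ν B x.1 x.2 := by
  have h : ∀ a, Measurable fun x : S × W =>
      max (inner ℝ ν (ψ x.1 a x.2) + β * wnorm B (ψ x.1 a x.2)) 0 := fun a => by
    have h : Measurable fun x : S × W => ψ x.1 a x.2 :=
      hψ.comp (measurable_fst.prodMk (measurable_const.prodMk measurable_snd))
    have h1 : Measurable fun x : S × W => inner ℝ ν (ψ x.1 a x.2) :=
      (show Continuous fun y : EuclideanSpace ℝ (Fin d) => inner ℝ ν y by
        fun_prop).measurable.comp h
    have h2 : Measurable fun x : S × W => wnorm B (ψ x.1 a x.2) :=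
      measurable_wnorm (fun _ _ => measurable_const) h
    exact (h1.add (h2.const_mul β)).max measurable_const
  exact (measurable_maxAct h).min measurable_const

theorem measurable_classFun_left [MeasurableSpace S] [MeasurableSpace A] [MeasurableSpace W]
    (hψ : Measurable fun x : S × A × W => ψ x.1 x.2.1 x.2.2) (w : W) :
    Measurable fun s : S => classFun H ψ β ν B s w :=
  Measurable.comp (g := fun x : S × W => classFun H ψ β ν B x.1 x.2) (f := fun s => (s, w))
    (measurable_classFun hψ) measurable_prodMk_right

theorem abs_coord_le_norm (x : EuclideanSpace ℝ (Fin d)) (i : Fin d) : |x.ofLp i| ≤ ‖x‖ := by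
  simpa using PiLp.norm_apply_le x i

theorem abs_dotProduct_le_of_coord {u v : Fin d → ℝ} {a b : ℝ} (ha : 0 ≤ a)
    (hu : ∀ i, |u i| ≤ a) (hv : ∀ i, |v i| ≤ b) : |u ⬝ᵥ v| ≤ d * (a * b) := by
  refine (Finset.abs_sum_le_sum_abs _ _).trans ?_
  refine (Finset.sum_le_sum (g := fun _ => a * b) fun i _ => ?_).trans (by simp)
  rw [abs_mul]
  exact mul_le_mul (hu i) (hv i) (abs_nonneg _) ha

/-- No sign condition is imposed because grid matrices need not be positive semidefinite; the square
root of a negative number is zero. -/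
theorem sqrt_le_sqrt_add_sqrt_abs_sub (a b : ℝ) : √a ≤ √b + √|a - b| := by
  have hb := Real.sqrt_nonneg b
  have h1 := Real.sqrt_nonneg |a - b|
  refine Real.sqrt_le_iff.2 ⟨by positivity, ?_⟩
  have h2 := Real.sq_sqrt (abs_nonneg (a - b))
  have h3 : b ≤ √b ^ 2 := by
    rcases le_total 0 b with h | h
    · exact (Real.sq_sqrt h).ge
    · exact h.trans (sq_nonneg _)
  nlinarith [le_abs_self (a - b), mul_nonneg hb h1]

/-- Entrywise errors `ε` change the quadratic form by at most `d² ε`, hence its root by `d √ε`. This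
square root dictates the fineness of the mesh. -/
theorem wnorm_le_add {B B' : Matrix (Fin d) (Fin d) ℝ} {ε : ℝ} (hε : 0 ≤ ε)
    (h : ∀ i j, |B i j - B' i j| ≤ ε) {y : EuclideanSpace ℝ (Fin d)} (hy : ‖y‖ ≤ 1) :
    wnorm B y ≤ wnorm B' y + d * √ε := by
  refine (sqrt_le_sqrt_add_sqrt_abs_sub _ (y.ofLp ⬝ᵥ B' *ᵥ y.ofLp)).trans ?_
  refine add_le_add_right ?_ _
  have hc : ∀ i, |y.ofLp i| ≤ 1 := fun i => (abs_coord_le_norm y i).trans hy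
  rw [← dotProduct_sub, ← sub_mulVec]
  have h1 : |y.ofLp ⬝ᵥ (B - B') *ᵥ y.ofLp| ≤ d * (1 * (d * (ε * 1))) :=
    abs_dotProduct_le_of_coord zero_le_one hc fun i =>
      abs_dotProduct_le_of_coord hε (fun j => by simpa using h i j) hc
  refine (Real.sqrt_le_sqrt h1).trans (le_of_eq ?_)
  rw [show (d : ℝ) * (1 * (d * (ε * 1))) = d ^ 2 * ε by ring, Real.sqrt_mul (by positivity),
    Real.sqrt_sq (Nat.cast_nonneg d)]

theorem classFun_le_add {ν' : EuclideanSpace ℝ (Fin d)} {B' : Matrix (Fin d) (Fin d) ℝ} {ε : ℝ}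
    (hψ : ∀ s a w, ‖ψ s a w‖ ≤ 1) (hβ : 0 ≤ β) (hε : 0 ≤ ε)
    (hν : ∀ i, |ν.ofLp i - ν'.ofLp i| ≤ ε) (hB : ∀ i j, |B i j - B' i j| ≤ ε) (s : S) (w : W) :
    classFun H ψ β ν B s w ≤ classFun H ψ β ν' B' s w + (d * ε + β * (d * √ε)) := by
  have h0 : 0 ≤ d * ε + β * (d * √ε) := by positivity
  have key : ∀ a, max (inner ℝ ν (ψ s a w) + β * wnorm B (ψ s a w)) 0 ≤
      max (inner ℝ ν' (ψ s a w) + β * wnorm B' (ψ s a w)) 0 + (d * ε + β * (d * √ε)) := by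
    intro a
    have h1 : inner ℝ ν (ψ s a w) - inner ℝ ν' (ψ s a w) ≤ d * ε := by
      rw [inner_eq_dotProduct, inner_eq_dotProduct, ← sub_dotProduct]
      refine (le_abs_self _).trans ((abs_dotProduct_le_of_coord hε (b := 1) (fun i => hν i)
        fun i => (abs_coord_le_norm _ i).trans (hψ s a w)).trans (by rw [mul_one]))
    have h2 := mul_le_mul_of_nonneg_left (wnorm_le_add hε hB (hψ s a w)) hβ
    refine max_le ?_ (by positivity)
    have := le_max_left (inner ℝ ν' (ψ s a w) + β * wnorm B' (ψ s a w)) 0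
    linarith
  have := maxAct_le_add key
  unfold classFun
  rw [← min_add_add_right]
  exact min_le_min this (by linarith)

theorem abs_classFun_sub_le {ν' : EuclideanSpace ℝ (Fin d)} {B' : Matrix (Fin d) (Fin d) ℝ} {ε : ℝ}
    (hψ : ∀ s a w, ‖ψ s a w‖ ≤ 1) (hβ : 0 ≤ β) (hε : 0 ≤ ε)
    (hν : ∀ i, |ν.ofLp i - ν'.ofLp i| ≤ ε) (hB : ∀ i j, |B i j - B' i j| ≤ ε) (s : S) (w : W) :
    |classFun H ψ β ν B s w - classFun H ψ β ν' B' s w| ≤ d * ε + β * (d * √ε) := by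
  have h1 := classFun_le_add (H := H) hψ hβ hε hν hB s w
  have h2 := classFun_le_add (H := H) (ν := ν') (ν' := ν) (B := B') (B' := B) hψ hβ hε
    (fun i => by rw [abs_sub_comm]; exact hν i) (fun i j => by rw [abs_sub_comm]; exact hB i j) s w
  rw [abs_le]
  constructor <;> linarith

theorem classFun_mem_valueClass {L : Matrix (Fin d) (Fin d) ℝ} (hL : L.PosDef) :
    classFun H ψ β ν L⁻¹ ∈ valueClass H ψ :=
  ⟨ν, β, L, hL, rfl⟩

theorem Vfun_eq_classFun {r : ℕ → S → A → W → ℝ} {η : ℕ → EuclideanSpace ℝ (Fin d)} {lam : ℝ}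
    {h k : ℕ} (hh : h < H) (hr : ∀ s a w, r h s a w = inner ℝ (η h) (ψ s a w))
    (D : Log S A W) : Vfun r H ψ lam β D k h =
      classFun H ψ β (η h + lsqParam r H ψ lam β D k h) (gram ψ lam D h k)⁻¹ := by
  ext s w
  simp only [Vfun, classFun, Qfun_of_lt hh, hr, inner_add_left]

theorem Vfun_of_le {r : ℕ → S → A → W → ℝ} {lam : ℝ} {h k : ℕ} (hh : H ≤ h) (D : Log S A W)
    (s : S) (w : W) : Vfun r H ψ lam β D k h s w = 0 := by
  simp [Vfun, Qfun_of_le hh, maxAct]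

theorem Vfun_mem_Icc {r : ℕ → S → A → W → ℝ} {lam : ℝ} {h k : ℕ} (D : Log S A W)
    (s : S) (w : W) : Vfun r H ψ lam β D k h s w ∈ Set.Icc (0 : ℝ) H :=
  ⟨le_min (maxAct_nonneg fun _ => Qfun_nonneg _ _ _) (Nat.cast_nonneg H),
    min_le_right _ _⟩

end FunctionClass

/-! ### The net and the union bound. -/

section Net

open Matrix

/-- The grid point with integer coordinates `n` and mesh `ε`. -/
def gridVec {d : ℕ} (ε : ℝ) (n : Fin d → ℤ) : EuclideanSpace ℝ (Fin d) :=
  WithLp.toLp 2 fun i => ε * n i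

/-- The grid matrix with integer coordinates `n` and mesh `ε`. -/
def gridMat {d : ℕ} (ε : ℝ) (n : Fin d → Fin d → ℤ) : Matrix (Fin d) (Fin d) ℝ :=
  Matrix.of fun i j => ε * n i j

theorem exists_grid_point {ε R : ℝ} {N : ℕ} (hε : 0 < ε) (hN : R / ε + 1 ≤ N) {v : ℝ}
    (hv : |v| ≤ R) : ∃ n ∈ Finset.Icc (-(N : ℤ)) N, |v - ε * n| ≤ ε := by
  obtain ⟨h1, h2⟩ := abs_le.1 hv
  have h3 : v / ε ≤ R / ε := by gcongr
  have h4 : -(R / ε) ≤ v / ε := by rw [← neg_div]; gcongr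
  have h5 := Int.floor_le (v / ε)
  have h6 := Int.lt_floor_add_one (v / ε)
  have e : v = ε * (v / ε) := by field_simp
  refine ⟨⌊v / ε⌋, Finset.mem_Icc.2 ⟨?_, ?_⟩, ?_⟩
  · have : (-(N : ℤ) : ℝ) ≤ (⌊v / ε⌋ : ℝ) := by push_cast; linarith
    exact_mod_cast this
  · have : (⌊v / ε⌋ : ℝ) ≤ (N : ℤ) := by push_cast; linarith
    exact_mod_cast this
  · rw [show v - ε * (⌊v / ε⌋ : ℝ) = ε * (v / ε - ⌊v / ε⌋) by rw [mul_sub, ← e], abs_mul,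
      abs_of_pos hε, abs_of_nonneg (by linarith)]
    exact mul_le_of_le_one_right hε.le (by linarith)

theorem exists_gridVec {d : ℕ} {ε R : ℝ} {N : ℕ} (hε : 0 < ε) (hN : R / ε + 1 ≤ N)
    {v : EuclideanSpace ℝ (Fin d)} (hv : ‖v‖ ≤ R) :
    ∃ n ∈ Fintype.piFinset fun _ : Fin d => Finset.Icc (-(N : ℤ)) N,
      ∀ i, |v.ofLp i - (gridVec ε n).ofLp i| ≤ ε := by
  choose n hn hn' using fun i => exists_grid_point hε hN ((abs_coord_le_norm v i).trans hv)
  exact ⟨n, Fintype.mem_piFinset.2 hn, hn'⟩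

theorem exists_gridMat {d : ℕ} {ε R : ℝ} {N : ℕ} (hε : 0 < ε) (hN : R / ε + 1 ≤ N)
    {B : Matrix (Fin d) (Fin d) ℝ} (hB : ∀ i j, |B i j| ≤ R) :
    ∃ n ∈ Fintype.piFinset fun _ : Fin d => Fintype.piFinset fun _ : Fin d =>
        Finset.Icc (-(N : ℤ)) N,
      ∀ i j, |B i j - gridMat ε n i j| ≤ ε := by
  choose n hn hn' using fun i j => exists_grid_point hε hN (hB i j)
  exact ⟨n, Fintype.mem_piFinset.2 fun i => Fintype.mem_piFinset.2 (hn i), hn'⟩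

variable {S A W Ω : Type*} [MeasurableSpace S] [MeasurableSpace A] [MeasurableSpace W]
  [Fintype A] [Nonempty A] {d : ℕ}

/-- The integer parameters of the net: a direction, the vector and the matrix of a function of the
class, a step and an episode. -/
def netIndex (d H K N : ℕ) :
    Finset ((Fin d → ℤ) × (Fin d → ℤ) × (Fin d → Fin d → ℤ) × ℕ × ℕ) :=
  (Fintype.piFinset fun _ => Finset.Icc (-(N : ℤ)) N) ×ˢ
    (Fintype.piFinset fun _ => Finset.Icc (-(N : ℤ)) N) ×ˢ
    (Fintype.piFinset fun _ => Fintype.piFinset fun _ => Finset.Icc (-(N : ℤ)) N) ×ˢ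
    Finset.range H ×ˢ Finset.range K

theorem card_netIndex (d H K N : ℕ) :
    (netIndex d H K N).card = (2 * N + 1) ^ (2 * d + d ^ 2) * (H * K) := by
  have h : ((N : ℤ) + 1 - -(N : ℤ)).toNat = 2 * N + 1 := by omega
  simp only [netIndex, Finset.card_product, Fintype.card_piFinset, Int.card_Icc, h,
    Finset.prod_const, Finset.card_univ, Fintype.card_fin, Finset.card_range]
  ring

/-- The exponent of the supermartingale that belongs to the direction `x` and the function `f`. -/
def logMartingale (M : ContextualMDP S A W) (H : ℕ) (ψ : S → A → W → EuclideanSpace ℝ (Fin d))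
    (D : Log S A W) (x : EuclideanSpace ℝ (Fin d)) (f : S → W → ℝ) (h k : ℕ) : ℝ :=
  ∑ τ ∈ Finset.range k, (inner ℝ x (D.feature ψ h τ) *
      increment M D τ h (fun s => f s (D.ctx τ)) - (inner ℝ x (D.feature ψ h τ) * H) ^ 2 / 8)

/-- All the supermartingales of the net stay below the level `L`. -/
def NetGood (M : ContextualMDP S A W) (H K : ℕ) (ψ : S → A → W → EuclideanSpace ℝ (Fin d))
    (β ε : ℝ) (N : ℕ) (L : ℝ) (D : Log S A W) : Prop :=
  ∀ j ∈ netIndex d H K N, logMartingale M H ψ D (gridVec ε j.1)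
    (classFun H ψ β (gridVec ε j.2.1) (gridMat ε j.2.2.1)) j.2.2.2.1 j.2.2.2.2 < L

theorem Interaction.measure_not_netGood_le {mΩ : MeasurableSpace Ω} {μ : Measure Ω}
    [IsProbabilityMeasure μ] {M : ContextualMDP S A W} {H K : ℕ} (I : Interaction M H K μ)
    {ψ : S → A → W → EuclideanSpace ℝ (Fin d)}
    (hψ : Measurable fun x : S × A × W => ψ x.1 x.2.1 x.2.2) (β ε : ℝ) (N : ℕ) (L : ℝ) :
    μ {ω | ¬ NetGood M H K ψ β ε N L (I.log ω)} ≤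
      ENNReal.ofReal ((2 * N + 1) ^ (2 * d + d ^ 2) * (H * K) * Real.exp (-L)) := by
  have hsub : {ω | ¬ NetGood M H K ψ β ε N L (I.log ω)} ⊆ ⋃ j ∈ netIndex d H K N,
      {ω | L ≤ logMartingale M H ψ (I.log ω) (gridVec ε j.1)
        (classFun H ψ β (gridVec ε j.2.1) (gridMat ε j.2.2.1)) j.2.2.2.1 j.2.2.2.2} := by
    intro ω hω
    simp only [NetGood, Set.mem_ofPred_eq] at hω
    push Not at hω
    simpa using hω
  refine (measure_mono hsub).trans ((measure_biUnion_finset_le _ _).trans ?_)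
  refine (Finset.sum_le_sum (g := fun _ => ENNReal.ofReal (Real.exp (-L))) fun j hj => ?_).trans ?_
  · simp only [netIndex, Finset.mem_product, Finset.mem_range] at hj
    exact I.measure_dotProduct_ge_le hψ (measurable_classFun hψ) classFun_mem_Icc _
      hj.2.2.2.1 hj.2.2.2.2.le L
  · rw [Finset.sum_const, card_netIndex, nsmul_eq_mul, ENNReal.ofReal_mul (by positivity),
      ← ENNReal.ofReal_natCast]
    push_cast
    exact le_rfl

end Net

/-! ### Discretization error and self-normalized noise. -/

section Increments

variable {S A W : Type*} [MeasurableSpace S] [MeasurableSpace A] [MeasurableSpace W]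
  {M : ContextualMDP S A W} {D : Log S A W} {b : ℝ}

theorem integrable_of_mem_Icc {ν : Measure S} [IsFiniteMeasure ν] {g : S → ℝ} (hg : Measurable g)
    {a b : ℝ} (hb : ∀ s, g s ∈ Set.Icc a b) : Integrable g ν :=
  Integrable.of_mem_Icc a b hg.aemeasurable (Filter.Eventually.of_forall hb)

theorem integral_mem_Icc {ν : Measure S} [IsProbabilityMeasure ν] {g : S → ℝ} (hg : Measurable g)
    {a b : ℝ} (hb : ∀ s, g s ∈ Set.Icc a b) : ∫ s, g s ∂ν ∈ Set.Icc a b := by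
  have hi : Integrable g ν := integrable_of_mem_Icc hg hb
  constructor
  · simpa using integral_mono (integrable_const a) hi fun s => (hb s).1
  · simpa using integral_mono hi (integrable_const b) fun s => (hb s).2

theorem abs_increment_le {g : S → ℝ} (hg : Measurable g) (hb : ∀ s, g s ∈ Set.Icc 0 b) (k h : ℕ) :
    |increment M D k h g| ≤ b := by
  obtain ⟨h1, h2⟩ := hb (D.state k (h + 1))
  obtain ⟨h3, h4⟩ := integral_mem_Icc (ν := M.P h (D.state k h, D.action k h)) hg hb
  rw [increment, abs_le]
  constructor <;> linarith

theorem abs_increment_sub_le {g g' : S → ℝ} (hg : Measurable g) (hg' : Measurable g')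
    (hb : ∀ s, g s ∈ Set.Icc 0 b) (hb' : ∀ s, g' s ∈ Set.Icc 0 b) {δ : ℝ}
    (hδ : ∀ s, |g s - g' s| ≤ δ) (k h : ℕ) :
    |increment M D k h g - increment M D k h g'| ≤ 2 * δ := by
  have h1 := hδ (D.state k (h + 1))
  have h2 : |∫ s, (g s - g' s) ∂(M.P h (D.state k h, D.action k h))| ≤ δ := by
    have := norm_integral_le_of_norm_le_const (μ := M.P h (D.state k h, D.action k h))
      (f := fun s => g s - g' s) (C := δ) (Filter.Eventually.of_forall fun s => hδ s)
    simpa using this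
  rw [integral_sub (integrable_of_mem_Icc hg hb) (integrable_of_mem_Icc hg' hb')] at h2
  rw [abs_le] at *
  unfold increment
  constructor <;> linarith

end Increments

/-- The difference splits into `a (e - e')`, `(a - a') e'` and `b² (a'² - a²) / 8`, which are
bounded one by one. -/
theorem martingale_term_le {a a' e e' R ρ δ b : ℝ} (ha : |a| ≤ R) (haa : |a - a'| ≤ ρ)
    (he : |e'| ≤ b) (hee : |e - e'| ≤ 2 * δ) :
    a * e - (a * b) ^ 2 / 8 ≤ a' * e' - (a' * b) ^ 2 / 8 +
      (ρ * b + 2 * R * δ + b ^ 2 * ρ * (2 * R + ρ) / 8) := by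
  have hR : 0 ≤ R := (abs_nonneg a).trans ha
  have hρ : 0 ≤ ρ := (abs_nonneg _).trans haa
  have h1 : a * (e - e') ≤ R * (2 * δ) := by
    refine (le_abs_self _).trans ?_
    rw [abs_mul]
    exact mul_le_mul ha hee (abs_nonneg _) hR
  have h2 : (a - a') * e' ≤ ρ * b := by
    refine (le_abs_self _).trans ?_
    rw [abs_mul]
    exact mul_le_mul haa he (abs_nonneg _) hρ
  have h3 : a' ^ 2 - a ^ 2 ≤ ρ * (2 * R + ρ) := by
    have : (a' - a) * (a' + a) ≤ ρ * (2 * R + ρ) := by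
      refine (le_abs_self _).trans ?_
      rw [abs_mul, abs_sub_comm]
      refine mul_le_mul haa ?_ (abs_nonneg _) hρ
      rw [show a' + a = 2 * a - (a - a') by ring]
      refine (abs_sub _ _).trans ?_
      rw [abs_mul, abs_two]
      linarith
    nlinarith
  have h4 := mul_le_mul_of_nonneg_left h3 (sq_nonneg b)
  nlinarith

section GramBounds

open Matrix

variable {S A W : Type*} {d : ℕ} {D : Log S A W} {ψ : S → A → W → EuclideanSpace ℝ (Fin d)}

theorem norm_gram_inv_mulVec_sum_le (hψ : ∀ s a w, ‖ψ s a w‖ ≤ 1) {h k : ℕ} {c : ℕ → ℝ} {b : ℝ}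
    (hc : ∀ τ, |c τ| ≤ b) :
    ‖(WithLp.toLp 2 ((gram ψ 1 D h k)⁻¹ *ᵥ (∑ τ ∈ Finset.range k, c τ • (D.feature ψ h τ).ofLp)) :
      EuclideanSpace ℝ (Fin d))‖ ≤ k * b := by
  have e : ∑ τ ∈ Finset.range k, c τ • (D.feature ψ h τ).ofLp =
      (∑ τ ∈ Finset.range k, c τ • D.feature ψ h τ).ofLp := by
    simp [WithLp.ofLp_sum]
  rw [e]
  refine (norm_gram_inv_mulVec_le ψ D h k _).trans ((norm_sum_le _ _).trans ?_)
  refine (Finset.sum_le_sum (g := fun _ => b) fun τ _ => ?_).trans (by simp)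
  rw [norm_smul, Real.norm_eq_abs]
  exact (mul_le_of_le_one_right (abs_nonneg _) (hψ _ _ _)).trans (hc τ)

theorem abs_gram_inv_apply_le (h k : ℕ) (i j : Fin d) : |(gram ψ 1 D h k)⁻¹ i j| ≤ 1 := by
  have h1 := norm_gram_inv_mulVec_le ψ D h k (EuclideanSpace.single j 1)
  have h2 := (abs_coord_le_norm _ i).trans h1
  simpa using h2

theorem mulVec_gram (h k : ℕ) (v : EuclideanSpace ℝ (Fin d)) : gram ψ 1 D h k *ᵥ v.ofLp =
    v.ofLp + ∑ τ ∈ Finset.range k, inner ℝ (D.feature ψ h τ) v • (D.feature ψ h τ).ofLp := by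
  induction k with
  | zero => simp [gram_zero]
  | succ k ih =>
    rw [gram_succ, add_mulVec, ih, Finset.sum_range_succ, vecMulVec_mulVec, add_assoc,
      inner_eq_dotProduct]
    simp

theorem abs_dotProduct_le_sqrt_mul {G : Matrix (Fin d) (Fin d) ℝ} (hG : G.PosDef)
    (v y : EuclideanSpace ℝ (Fin d)) :
    |v.ofLp ⬝ᵥ y.ofLp| ≤ √(y.ofLp ⬝ᵥ G *ᵥ y.ofLp) * wnorm G⁻¹ v := by
  have h1 := cauchySchwarz_dotProduct hG v.ofLp y.ofLp
  have h2 := Real.abs_le_sqrt h1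
  rwa [mul_comm, Real.sqrt_mul (posDef_quad_nonneg hG _)] at h2

end GramBounds

section Noise

open Matrix

variable {S A W : Type*} [MeasurableSpace S] [MeasurableSpace A] [MeasurableSpace W]
  {d H : ℕ} {M : ContextualMDP S A W} {D : Log S A W}
  {ψ : S → A → W → EuclideanSpace ℝ (Fin d)} {L : ℝ}

theorem logMartingale_le_add (hψ : ∀ s a w, ‖ψ s a w‖ ≤ 1) {R ρ δ : ℝ}
    {x x' : EuclideanSpace ℝ (Fin d)} (hx : ‖x‖ ≤ R)
    (hxx : ∀ y : EuclideanSpace ℝ (Fin d), ‖y‖ ≤ 1 → |inner ℝ x y - inner ℝ x' y| ≤ ρ)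
    {f f' : S → W → ℝ} (hf : ∀ w, Measurable fun s => f s w) (hf' : ∀ w, Measurable fun s => f' s w)
    (hb : ∀ s w, f s w ∈ Set.Icc (0 : ℝ) H) (hb' : ∀ s w, f' s w ∈ Set.Icc (0 : ℝ) H)
    (hδ : ∀ s w, |f s w - f' s w| ≤ δ) (h k : ℕ) :
    logMartingale M H ψ D x f h k ≤ logMartingale M H ψ D x' f' h k +
      k * (ρ * H + 2 * R * δ + (H : ℝ) ^ 2 * ρ * (2 * R + ρ) / 8) := by
  unfold logMartingale
  set c := ρ * H + 2 * R * δ + (H : ℝ) ^ 2 * ρ * (2 * R + ρ) / 8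
  rw [show (k : ℝ) * c = ∑ _τ ∈ Finset.range k, c by simp, ← Finset.sum_add_distrib]
  refine Finset.sum_le_sum fun τ _ => ?_
  have hf1 : ‖D.feature ψ h τ‖ ≤ 1 := hψ _ _ _
  exact martingale_term_le ((abs_real_inner_le_norm _ _).trans
    ((mul_le_of_le_one_right (norm_nonneg _) hf1).trans hx)) (hxx _ hf1)
    (abs_increment_le (hf' _) (fun s => hb' s _) τ h)
    (abs_increment_sub_le (hf _) (hf' _) (fun s => hb s _) (fun s => hb' s _) (fun s => hδ s _) τ h)

/-- The self-normalized norm of the noise vector is controlled by the supermartingales. -/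
theorem quad_noise_le {f : S → W → ℝ} {h k : ℕ} (hH : 0 < H) {u : EuclideanSpace ℝ (Fin d)}
    (hu : u.ofLp = (gram ψ 1 D h k)⁻¹ *ᵥ (∑ τ ∈ Finset.range k,
      increment M D τ h (fun s => f s (D.ctx τ)) • (D.feature ψ h τ).ofLp))
    (hlog : logMartingale M H ψ D ((4 / (H : ℝ) ^ 2) • u) f h k ≤ L + 1) :
    u.ofLp ⬝ᵥ gram ψ 1 D h k *ᵥ u.ofLp ≤ (H : ℝ) ^ 2 * ((L + 1) / 2) := by
  have hH' : (0 : ℝ) < H := by exact_mod_cast hH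
  have hG := gram_posDef ψ D h one_pos k
  set q := u.ofLp ⬝ᵥ gram ψ 1 D h k *ᵥ u.ofLp with hq
  have h1 : q = ∑ τ ∈ Finset.range k, inner ℝ u (D.feature ψ h τ) *
      increment M D τ h (fun s => f s (D.ctx τ)) := by
    rw [hq]
    nth_rewrite 2 [hu]
    rw [posDef_mulVec_inv_mulVec hG, dotProduct_sum]
    refine Finset.sum_congr rfl fun τ _ => ?_
    rw [dotProduct_smul, smul_eq_mul, inner_eq_dotProduct, mul_comm]
  have h2 : ∑ τ ∈ Finset.range k, inner ℝ u (D.feature ψ h τ) ^ 2 ≤ q := by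
    rw [hq, quad_gram, one_mul]
    simp only [inner_eq_dotProduct]
    refine le_add_of_nonneg_left ?_
    rw [← norm_sq_eq_dotProduct]
    positivity
  -- For direction `c u` the exponent is at least `c q - c² H² q / 8`. The scale `c = 4 / H²`
  -- maximizes this, with value `2q / H²`.
  have h3 : logMartingale M H ψ D ((4 / (H : ℝ) ^ 2) • u) f h k = 4 / (H : ℝ) ^ 2 * q -
      2 / (H : ℝ) ^ 2 * ∑ τ ∈ Finset.range k, inner ℝ u (D.feature ψ h τ) ^ 2 := by
    rw [h1, Finset.mul_sum, Finset.mul_sum, ← Finset.sum_sub_distrib]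
    refine Finset.sum_congr rfl fun τ _ => ?_
    rw [real_inner_smul_left]
    field_simp
    ring
  rw [h3] at hlog
  have h4 : 2 / (H : ℝ) ^ 2 * q ≤ L + 1 := by
    have := mul_le_mul_of_nonneg_left h2 (show 0 ≤ 2 / (H : ℝ) ^ 2 by positivity)
    have e : 4 / (H : ℝ) ^ 2 * q = 2 / (H : ℝ) ^ 2 * q + 2 / (H : ℝ) ^ 2 * q := by ring
    linarith
  calc q = (H : ℝ) ^ 2 / 2 * (2 / (H : ℝ) ^ 2 * q) := by field_simp
    _ ≤ (H : ℝ) ^ 2 / 2 * (L + 1) := mul_le_mul_of_nonneg_left h4 (by positivity)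
    _ = _ := by ring

end Noise

/-! ### Accuracy of the least-squares estimates on the good event. -/

section Deterministic

open Matrix

variable {S A W : Type*} [MeasurableSpace S] [MeasurableSpace A] [MeasurableSpace W]
  [Fintype A] [Nonempty A] {d H K : ℕ} {M : ContextualMDP S A W} {D : Log S A W}
  {ψ : S → A → W → EuclideanSpace ℝ (Fin d)} {η : ℕ → EuclideanSpace ℝ (Fin d)}
  {β ε R L : ℝ} {N : ℕ}

/-- On the good event of the net the supermartingales of all parameters are bounded. -/
theorem NetGood.logMartingale_le (hgood : NetGood M H K ψ β ε N L D)
    (hψm : Measurable fun x : S × A × W => ψ x.1 x.2.1 x.2.2) (hψ : ∀ s a w, ‖ψ s a w‖ ≤ 1)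
    (hβ : 0 ≤ β) (hε : 0 < ε) (hN : R / ε + 1 ≤ N)
    (hslack : K * (d * ε * H + 2 * R * (d * ε + β * (d * √ε)) +
      (H : ℝ) ^ 2 * (d * ε) * (2 * R + d * ε) / 8) ≤ 1)
    {x ν : EuclideanSpace ℝ (Fin d)} {B : Matrix (Fin d) (Fin d) ℝ} (hx : ‖x‖ ≤ R) (hν : ‖ν‖ ≤ R)
    (hB : ∀ i j, |B i j| ≤ R) {h k : ℕ} (hh : h < H) (hk : k < K) :
    logMartingale M H ψ D x (classFun H ψ β ν B) h k ≤ L + 1 := by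
  obtain ⟨n, hn, hn'⟩ := exists_gridVec hε hN hx
  obtain ⟨m, hm, hm'⟩ := exists_gridVec hε hN hν
  obtain ⟨b, hb, hb'⟩ := exists_gridMat hε hN hB
  have h1 := hgood (n, m, b, h, k) (by simp [netIndex, -Fintype.mem_piFinset, hn, hm, hb, hh, hk])
  have hR : 0 ≤ R := (norm_nonneg x).trans hx
  set c := d * ε * H + 2 * R * (d * ε + β * (d * √ε)) +
      (H : ℝ) ^ 2 * (d * ε) * (2 * R + d * ε) / 8 with hc
  have hc0 : 0 ≤ c := by positivity
  -- The function, direction and matrix are replaced by grid points at once; `hslack` makes the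
  -- total error over at most `K` episodes no more than 1.
  have h2 := logMartingale_le_add (M := M) (D := D) (H := H) hψ hx (x' := gridVec ε n)
    (ρ := d * ε) (δ := d * ε + β * (d * √ε)) (f := classFun H ψ β ν B)
    (f' := classFun H ψ β (gridVec ε m) (gridMat ε b))
    (fun y hy => by
      rw [inner_eq_dotProduct, inner_eq_dotProduct, ← sub_dotProduct]
      exact (abs_dotProduct_le_of_coord hε.le (b := 1) (fun i => hn' i)
        fun i => (abs_coord_le_norm _ i).trans hy).trans (by rw [mul_one]))
    (measurable_classFun_left hψm) (measurable_classFun_left hψm) classFun_mem_Icc classFun_mem_Icc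
    (abs_classFun_sub_le hψ hβ hε.le hm' hb') h k
  have h3 : k * c ≤ 1 := by
    refine le_trans ?_ hslack
    have : (k : ℝ) ≤ K := by exact_mod_cast hk.le
    gcongr
  dsimp only at h1
  rw [← hc] at h2
  linarith

/-- On the good event the least-squares estimates of the backups are accurate. -/
theorem NetGood.abs_backup_sub_le (hgood : NetGood M H K ψ β ε N L D)
    (hψm : Measurable fun x : S × A × W => ψ x.1 x.2.1 x.2.2) (hC : Completeness M H ψ η)
    (hBd : Boundedness H ψ η) (hβ : 0 ≤ β) (hε : 0 < ε) (hN : R / ε + 1 ≤ N)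
    (hslack : K * (d * ε * H + 2 * R * (d * ε + β * (d * √ε)) +
      (H : ℝ) ^ 2 * (d * ε) * (2 * R + d * ε) / 8) ≤ 1)
    (hR1 : 1 ≤ R) (hR2 : 4 * K ≤ R) (hR3 : √d + K * H ≤ R)
    (hβL : H * √d + H * √((L + 1) / 2) ≤ β) {h k : ℕ} (hh : h < H) (hk : k < K)
    (s : S) (a : A) (w : W) :
    |inner ℝ (lsqParam M.r H ψ 1 β D k h) (ψ s a w) -
      ∫ s', Vfun M.r H ψ 1 β D k (h + 1) s' w ∂(M.P h (s, a))| ≤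
      β * wnorm (gram ψ 1 D h k)⁻¹ (ψ s a w) := by
  have hψ := hBd.feature
  have hG := gram_posDef ψ D h one_pos k
  have hw0 : 0 ≤ wnorm (gram ψ 1 D h k)⁻¹ (ψ s a w) := Real.sqrt_nonneg _
  have hkK : (k : ℝ) ≤ K := by exact_mod_cast hk.le
  have hH1 : (1 : ℝ) ≤ H := by exact_mod_cast (show 1 ≤ H by omega)
  rcases Nat.lt_or_ge (h + 1) H with hh1 | hh1
  · obtain ⟨f, hf⟩ : ∃ f, f = Vfun M.r H ψ 1 β D k (h + 1) := ⟨_, rfl⟩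
    have hfc := Vfun_eq_classFun (lam := 1) (β := β) (k := k) hh1 (hC.reward (h + 1) hh1) D
    rw [← hf] at hfc ⊢
    set ν := η (h + 1) + lsqParam M.r H ψ 1 β D k (h + 1) with hν
    have hνR : ‖ν‖ ≤ R := by
      refine (norm_add_le _ _).trans (le_trans (add_le_add (hBd.reward (h + 1) hh1) ?_) hR3)
      refine (norm_gram_inv_mulVec_sum_le hψ (b := H) fun τ => ?_).trans (by gcongr)
      obtain ⟨h0, h1⟩ := Vfun_mem_Icc (r := M.r) (H := H) (ψ := ψ) (β := β) (lam := 1)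
        (h := h + 1 + 1) (k := k) D (D.state τ (h + 1 + 1)) (D.ctx τ)
      rwa [abs_of_nonneg h0]
    have hfm : ∀ w, Measurable fun s => f s w := fun w => by
      rw [hfc]; exact measurable_classFun_left hψm w
    have hfI : ∀ s w, f s w ∈ Set.Icc (0 : ℝ) H := fun s w => by rw [hfc]; exact classFun_mem_Icc s w
    obtain ⟨νs, hνs, hback⟩ := hC.backup f
      (by rw [hfc]; exact classFun_mem_valueClass (gram_posDef ψ D (h + 1) one_pos k)) h hh
    set z : Fin d → ℝ := ∑ τ ∈ Finset.range k,
      increment M D τ h (fun s => f s (D.ctx τ)) • (D.feature ψ h τ).ofLp with hz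
    set u : EuclideanSpace ℝ (Fin d) := WithLp.toLp 2 ((gram ψ 1 D h k)⁻¹ *ᵥ z) with hu
    have huK : ‖u‖ ≤ k * H := norm_gram_inv_mulVec_sum_le hψ fun τ =>
      abs_increment_le (hfm _) (fun s => hfI s _) τ h
    have hxR : ‖(4 / (H : ℝ) ^ 2) • u‖ ≤ R := by
      rw [norm_smul, Real.norm_of_nonneg (by positivity)]
      calc 4 / (H : ℝ) ^ 2 * ‖u‖ ≤ 4 / (H : ℝ) ^ 2 * ((k : ℝ) * H) := by gcongr
        _ = 4 * (k : ℝ) / H := by field_simp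
        _ ≤ 4 * (k : ℝ) := div_le_self (by positivity) hH1
        _ ≤ 4 * (K : ℝ) := by gcongr
        _ ≤ R := hR2
    have hlog := hgood.logMartingale_le hψm hψ hβ hε hN hslack hxR hνR
      (fun i j => (abs_gram_inv_apply_le (ψ := ψ) (D := D) (h + 1) k i j).trans hR1) hh hk
    rw [← hfc] at hlog
    have hq := quad_noise_le (by omega) (u := u) rfl hlog
    set v : EuclideanSpace ℝ (Fin d) := WithLp.toLp 2 ((gram ψ 1 D h k)⁻¹ *ᵥ νs.ofLp) with hv
    -- By completeness each target is its increment plus `⟨ψ, νs⟩`, so the normal equations read `G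
    -- ν = z + G νs - νs`. Thus `u = G⁻¹ z` is the noise and `v = G⁻¹ νs` the ridge bias.
    have hdec : (lsqParam M.r H ψ 1 β D k h).ofLp - νs.ofLp = u.ofLp - v.ofLp := by
      have e1 : ∑ τ ∈ Finset.range k, f (D.state τ (h + 1)) (D.ctx τ) • (D.feature ψ h τ).ofLp =
          z + (gram ψ 1 D h k *ᵥ νs.ofLp - νs.ofLp) := by
        rw [mulVec_gram, add_sub_cancel_left, hz, ← Finset.sum_add_distrib]
        refine Finset.sum_congr rfl fun τ _ => ?_
        rw [← add_smul, increment, hback]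
        congr 1
        simp [Log.feature]
      have e2 : (lsqParam M.r H ψ 1 β D k h).ofLp =
          (gram ψ 1 D h k)⁻¹ *ᵥ (z + (gram ψ 1 D h k *ᵥ νs.ofLp - νs.ofLp)) := by
        rw [← e1, hf]; rfl
      rw [e2, mulVec_add, mulVec_sub, posDef_inv_mulVec_mulVec hG, hu, hv]
      simp only
      abel
    rw [hback, inner_eq_dotProduct, inner_eq_dotProduct, dotProduct_comm, ← dotProduct_sub, hdec,
      dotProduct_sub]
    have h1 := abs_dotProduct_le_sqrt_mul hG (ψ s a w) u
    have h2 := abs_dotProduct_le_sqrt_mul hG (ψ s a w) v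
    have h3 : √(u.ofLp ⬝ᵥ gram ψ 1 D h k *ᵥ u.ofLp) ≤ H * √((L + 1) / 2) := by
      refine (Real.sqrt_le_sqrt hq).trans (le_of_eq ?_)
      rw [Real.sqrt_mul (by positivity), Real.sqrt_sq (by positivity)]
    have h4 : √(v.ofLp ⬝ᵥ gram ψ 1 D h k *ᵥ v.ofLp) ≤ H * √d := by
      refine Real.sqrt_le_iff.2 ⟨by positivity, ?_⟩
      rw [hv]
      dsimp only
      rw [posDef_mulVec_inv_mulVec hG, dotProduct_comm]
      exact (quad_gram_inv_le_norm_sq ψ D h k νs).trans (by gcongr)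
    refine (abs_sub _ _).trans ((add_le_add h1 h2).trans ?_)
    rw [← add_mul]
    exact mul_le_mul_of_nonneg_right (by linarith) hw0
  -- At the last step the next value function is zero, so the estimate is exact.
  · have hV : ∀ s w, Vfun M.r H ψ 1 β D k (h + 1) s w = 0 := fun s w => Vfun_of_le hh1 D s w
    have hl : lsqParam M.r H ψ 1 β D k h = 0 := by
      simp [lsqParam, hV]
    simp only [hV, hl, inner_zero_left, integral_zero, sub_zero, abs_zero]
    positivity

end Deterministic

section PolicyValues

variable {S A W : Type*} [MeasurableSpace S] [MeasurableSpace A] [MeasurableSpace W]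

theorem ContextualMDP.measurable_value_left (M : ContextualMDP S A W) (H : ℕ) (p : Policy S A W)
    (h : ℕ) (w : W) : Measurable fun s => M.value H p h s w :=
  (M.measurable_value H (α := Unit) (π := fun _ => p)
    (fun h _ => (p.measurable_act h).comp measurable_snd) h).comp
    (measurable_const (a := ()) |>.prodMk (measurable_id.prodMk (measurable_const (a := w))))

theorem ContextualMDP.value_mem_Icc (M : ContextualMDP S A W) (H : ℕ) (p : Policy S A W)
    (h : ℕ) (s : S) (w : W) : M.value H p h s w ∈ Set.Icc (0 : ℝ) H :=
  ⟨M.value_nonneg H p w h s, M.value_le_horizon H p w h s⟩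

end PolicyValues

/-! ### Optimism and the unrolled Bellman recursion. -/

section Optimism

variable {S A W : Type*} [MeasurableSpace S] [MeasurableSpace A] [MeasurableSpace W]
  [Fintype A] [Nonempty A] {d H : ℕ} {M : ContextualMDP S A W} {D : Log S A W}
  {ψ : S → A → W → EuclideanSpace ℝ (Fin d)} {β : ℝ} {k : ℕ}

theorem measurable_Vfun_left (hψ : Measurable fun x : S × A × W => ψ x.1 x.2.1 x.2.2)
    {r : ℕ → S → A → W → ℝ} (hr : ∀ h, Measurable fun x : S × A × W => r h x.1 x.2.1 x.2.2)
    (lam : ℝ) (D : Log S A W) (k h : ℕ) (w : W) :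
    Measurable fun s => Vfun r H ψ lam β D k h s w := by
  have hD : MeasurableLog (fun _ : Unit => D) H k :=
    ⟨fun _ _ _ _ => measurable_const, fun _ _ _ _ => measurable_const,
      fun _ _ => measurable_const⟩
  refine (measurable_maxAct fun a => ?_).min measurable_const
  have := hD.Qfun (lam := lam) hψ hr β le_rfl h
  exact this.comp (measurable_const (a := ()) |>.prodMk
    (measurable_id.prodMk (measurable_const (a := (a, w)))))

/-- The least-squares estimates of plan `k` are accurate up to the bonus. -/
def Accurate (M : ContextualMDP S A W) (H : ℕ) (ψ : S → A → W → EuclideanSpace ℝ (Fin d))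
    (β : ℝ) (D : Log S A W) (k : ℕ) : Prop :=
  ∀ h < H, ∀ s a w, |inner ℝ (lsqParam M.r H ψ 1 β D k h) (ψ s a w) -
    ∫ s', Vfun M.r H ψ 1 β D k (h + 1) s' w ∂(M.P h (s, a))| ≤
      β * wnorm (gram ψ 1 D h k)⁻¹ (ψ s a w)

theorem integral_Vfun_nonneg {M : ContextualMDP S A W} (h k : ℕ) (s : S) (a : A) (w : W) :
    0 ≤ ∫ s', Vfun M.r H ψ 1 β D k (h + 1) s' w ∂(M.P h (s, a)) :=
  integral_nonneg fun _ => (Vfun_mem_Icc _ _ _).1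

theorem Accurate.le_Qfun (hacc : Accurate M H ψ β D k) {h : ℕ} (hh : h < H) (s : S) (a : A)
    (w : W) : M.r h s a w + ∫ s', Vfun M.r H ψ 1 β D k (h + 1) s' w ∂(M.P h (s, a)) ≤
      Qfun M.r H ψ 1 β D k h s a w := by
  rw [Qfun_of_lt hh]
  refine le_trans ?_ (le_max_left _ _)
  have := (abs_le.1 (hacc h hh s a w)).1
  linarith

theorem Accurate.Qfun_le (hacc : Accurate M H ψ β D k) (hβ : 0 ≤ β) {h : ℕ} (hh : h < H) (s : S)
    (a : A) (w : W) : Qfun M.r H ψ 1 β D k h s a w ≤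
      M.r h s a w + ∫ s', Vfun M.r H ψ 1 β D k (h + 1) s' w ∂(M.P h (s, a)) +
        2 * β * wnorm (gram ψ 1 D h k)⁻¹ (ψ s a w) := by
  rw [Qfun_of_lt hh]
  have h1 := (abs_le.1 (hacc h hh s a w)).2
  have h2 := M.r_nonneg h s a w
  have h3 := integral_Vfun_nonneg (ψ := ψ) (H := H) (M := M) (β := β) (D := D) h k s a w
  have h4 : 0 ≤ wnorm (gram ψ 1 D h k)⁻¹ (ψ s a w) := Real.sqrt_nonneg _
  refine max_le (by linarith) (by positivity)

/-- Backward induction: adding the bonus makes `Q` dominate the true backup, and truncation at `H`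
does no harm because values never exceed `H`. -/
theorem Accurate.value_le_Vfun (hacc : Accurate M H ψ β D k)
    (hψ : Measurable fun x : S × A × W => ψ x.1 x.2.1 x.2.2) (p : Policy S A W) (h : ℕ) (s : S)
    (w : W) : M.value H p h s w ≤ Vfun M.r H ψ 1 β D k h s w := by
  induction hn : H - h generalizing h s with
  | zero =>
    rw [M.value_of_le H p w (by omega)]
    exact (Vfun_mem_Icc _ _ _).1
  | succ n ih =>
    have hh : h < H := by omega
    refine le_min ?_ (M.value_le_horizon H p w h s)
    refine le_trans ?_ (le_maxAct (fun a => Qfun M.r H ψ 1 β D k h s a w) (p.act h (s, w)))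
    refine le_trans ?_ (hacc.le_Qfun hh s _ w)
    rw [M.value_eq H p w hh]
    refine add_le_add_right ?_ _
    refine integral_mono
      (integrable_of_mem_Icc (M.measurable_value_left H p _ w) fun s => M.value_mem_Icc H p _ s w)
      (integrable_of_mem_Icc (measurable_Vfun_left hψ M.measurable_r _ D k _ w)
        fun s => Vfun_mem_Icc _ s w) fun s' => ih (h + 1) s' (by omega)

theorem Accurate.optValue_le_Vfun (hacc : Accurate M H ψ β D k)
    (hψ : Measurable fun x : S × A × W => ψ x.1 x.2.1 x.2.2) (h : ℕ) (s : S) (w : W) :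
    M.optValue H h s w ≤ Vfun M.r H ψ 1 β D k h s w :=
  M.optValue_le H w fun p => hacc.value_le_Vfun hψ p h s w

/-- The gap between the value function of plan `k` and the value of a policy. -/
def valueGap (M : ContextualMDP S A W) (H : ℕ) (ψ : S → A → W → EuclideanSpace ℝ (Fin d))
    (β : ℝ) (D : Log S A W) (k : ℕ) (p : Policy S A W) (h : ℕ) (w : W) (s : S) : ℝ :=
  Vfun M.r H ψ 1 β D k h s w - M.value H p h s w

/-- Greediness bounds the value by `Q` at the played action, and `Q` exceeds the true backup by at
most two bonuses. Subtracting the policy's Bellman equation leaves the expected next gap, which is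
the realized gap minus its increment. The plan `k` may be older than the played episode `j`. -/
theorem Accurate.valueGap_le (hacc : Accurate M H ψ β D k) (hβ : 0 ≤ β)
    (hψ : Measurable fun x : S × A × W => ψ x.1 x.2.1 x.2.2) {p : Policy S A W} {j h : ℕ}
    (hh : h < H) (hact : D.action j h = p.act h (D.state j h, D.ctx j))
    (hgreedy : ∀ a, Qfun M.r H ψ 1 β D k h (D.state j h) a (D.ctx j) ≤
      Qfun M.r H ψ 1 β D k h (D.state j h) (D.action j h) (D.ctx j)) :
    valueGap M H ψ β D k p h (D.ctx j) (D.state j h) ≤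
      2 * β * wnorm (gram ψ 1 D h k)⁻¹ (D.feature ψ h j) -
        increment M D j h (valueGap M H ψ β D k p (h + 1) (D.ctx j)) +
      valueGap M H ψ β D k p (h + 1) (D.ctx j) (D.state j (h + 1)) := by
  have h1 : Vfun M.r H ψ 1 β D k h (D.state j h) (D.ctx j) ≤
      Qfun M.r H ψ 1 β D k h (D.state j h) (D.action j h) (D.ctx j) :=
    (min_le_left _ _).trans (maxAct_le_iff.2 hgreedy)
  have h2 := hacc.Qfun_le hβ hh (D.state j h) (D.action j h) (D.ctx j)
  have h3 := M.value_eq H p (D.ctx j) hh (D.state j h)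
  rw [← hact] at h3
  have h4 : ∫ s', valueGap M H ψ β D k p (h + 1) (D.ctx j) s'
      ∂(M.P h (D.state j h, D.action j h)) =
      ∫ s', Vfun M.r H ψ 1 β D k (h + 1) s' (D.ctx j) ∂(M.P h (D.state j h, D.action j h)) -
        ∫ s', M.value H p (h + 1) s' (D.ctx j) ∂(M.P h (D.state j h, D.action j h)) :=
    integral_sub (integrable_of_mem_Icc (measurable_Vfun_left hψ M.measurable_r _ D k _ _)
        fun s => Vfun_mem_Icc _ s _)
      (integrable_of_mem_Icc (M.measurable_value_left H p _ _) fun s => M.value_mem_Icc H p _ s _)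
  rw [increment, h4]
  unfold valueGap Log.feature
  linarith

theorem Accurate.valueGap_zero_le (hacc : Accurate M H ψ β D k) (hβ : 0 ≤ β)
    (hψ : Measurable fun x : S × A × W => ψ x.1 x.2.1 x.2.2) {p : Policy S A W} {j : ℕ}
    (hact : ∀ h < H, D.action j h = p.act h (D.state j h, D.ctx j))
    (hgreedy : ∀ h < H, ∀ a, Qfun M.r H ψ 1 β D k h (D.state j h) a (D.ctx j) ≤
      Qfun M.r H ψ 1 β D k h (D.state j h) (D.action j h) (D.ctx j)) :
    valueGap M H ψ β D k p 0 (D.ctx j) (D.state j 0) ≤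
      ∑ h ∈ Finset.range H, (2 * β * wnorm (gram ψ 1 D h k)⁻¹ (D.feature ψ h j) -
        increment M D j h (valueGap M H ψ β D k p (h + 1) (D.ctx j))) := by
  have key : ∀ n ≤ H, valueGap M H ψ β D k p 0 (D.ctx j) (D.state j 0) ≤
      ∑ h ∈ Finset.range n, (2 * β * wnorm (gram ψ 1 D h k)⁻¹ (D.feature ψ h j) -
        increment M D j h (valueGap M H ψ β D k p (h + 1) (D.ctx j))) +
      valueGap M H ψ β D k p n (D.ctx j) (D.state j n) := by
    intro n hn
    induction n with
    | zero => simp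
    | succ n ih =>
      rw [Finset.sum_range_succ]
      have := hacc.valueGap_le hβ hψ (by omega) (hact n (by omega)) (hgreedy n (by omega))
      linarith [ih (by omega)]
  have h0 : valueGap M H ψ β D k p H (D.ctx j) (D.state j H) = 0 := by
    rw [valueGap, Vfun_of_le le_rfl, M.value_of_le H p _ le_rfl, sub_zero]
  have := key H le_rfl
  rwa [h0, add_zero] at this

end Optimism

/-! ### Regret decomposition and the Azuma-Hoeffding bound. -/

section Regret

open scoped ENNReal

variable {S A W Ω : Type*} [MeasurableSpace S] [MeasurableSpace A] [MeasurableSpace W]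
  [Fintype A] [Nonempty A] {mΩ : MeasurableSpace Ω} {μ : Measure Ω} {d H K : ℕ}
  {M : ContextualMDP S A W} {ψ : S → A → W → EuclideanSpace ℝ (Fin d)} {β : ℝ}

/-- The gap between the value function used in episode `k` and the value of the policy. -/
def Interaction.gap (I : Interaction M H K μ) (ψ : S → A → W → EuclideanSpace ℝ (Fin d)) (β : ℝ)
    (k h : ℕ) (ω : Ω) : S → ℝ :=
  valueGap M H ψ β (I.log ω) (planUsed H ψ 1 (I.log ω) k) (I.policy k ω) h (I.ctx k ω)

/-- The martingale part of the regret. -/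
def Interaction.noise (I : Interaction M H K μ) (ψ : S → A → W → EuclideanSpace ℝ (Fin d))
    (β : ℝ) (k h : ℕ) (ω : Ω) : ℝ :=
  increment M (I.log ω) k h (I.gap ψ β k (h + 1) ω)

theorem Interaction.regret_le (I : Interaction M H K μ) (hrun : I.RunsLSVI ψ 1 β) (hβ : 0 ≤ β)
    (hψ : Measurable fun x : S × A × W => ψ x.1 x.2.1 x.2.2) {ω : Ω}
    (hacc : ∀ k < K, Accurate M H ψ β (I.log ω) k) :
    I.regret ω ≤ 2 * β * ∑ h ∈ Finset.range H, ∑ k ∈ Finset.range K,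
        wnorm (gram ψ 1 (I.log ω) h (planUsed H ψ 1 (I.log ω) k))⁻¹ ((I.log ω).feature ψ h k) -
      ∑ k ∈ Finset.range K, ∑ h ∈ Finset.range H, I.noise ψ β k h ω := by
  rw [Finset.sum_comm, Finset.mul_sum, ← Finset.sum_sub_distrib]
  refine Finset.sum_le_sum fun k hk => ?_
  have hk' := Finset.mem_range.1 hk
  have hacc' := hacc _ ((planUsed_le ψ (lam := 1) (I.log ω) H k).trans_lt hk')
  rw [Finset.mul_sum, ← Finset.sum_sub_distrib]
  have h1 := hacc'.optValue_le_Vfun hψ 0 (I.state k 0 ω) (I.ctx k ω)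
  have h2 := hacc'.valueGap_zero_le hβ hψ (p := I.policy k ω) (j := k) (fun h _ => rfl)
    (fun h hh a => hrun k hk' h hh ω (I.state k h ω) (I.ctx k ω) a)
  refine le_trans ?_ h2
  exact sub_le_sub_right h1 _

/-- Plan, policy and context are all known when the episode starts, so the gap functions are
predictable and the noise terms are martingale differences. -/
theorem Interaction.measurable_gap (I : Interaction M H K μ)
    (hψ : Measurable fun x : S × A × W => ψ x.1 x.2.1 x.2.2) (β : ℝ) {k : ℕ} (hk : k < K)
    (h h' : ℕ) : Measurable[(I.filt (clock H k h')).prod (inferInstance : MeasurableSpace S)]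
      fun x : Ω × S => I.gap ψ β k h x.1 x.2 := by
  have hV := @MeasurableLog.Vfun_planUsed S A W Ω _ _ _ (I.filt (clock H k 0)) d I.log H k ψ 1 _ _
    (I.measurableLog hk.le) hψ M.r M.measurable_r β h
  have hval := @ContextualMDP.measurable_value S A W Ω _ _ _ (I.filt (clock H k 0)) M H (I.policy k)
    (I.measurable_policy k hk) h
  have hmap : Measurable[(I.filt (clock H k h')).prod (inferInstance : MeasurableSpace S),
      (I.filt (clock H k 0)).prod (inferInstance : MeasurableSpace (S × W))]
      fun x : Ω × S => (x.1, (x.2, I.ctx k x.1)) := by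
    have hle := I.filt.mono (clock_zero_le H k h')
    have h1 : Measurable[(I.filt (clock H k h')).prod (inferInstance : MeasurableSpace S),
        I.filt (clock H k 0)] fun x : Ω × S => x.1 :=
      (@measurable_fst Ω S (I.filt (clock H k h')) _).mono le_rfl hle
    exact h1.prodMk ((@measurable_snd Ω S (I.filt (clock H k h')) _).prodMk
      ((I.measurable_ctx k hk).comp h1))
  exact (hV.sub hval).comp hmap

theorem sum_range_mul_eq (f : ℕ → ℕ → ℝ) {H : ℕ} (hH : 0 < H) (K : ℕ) :
    ∑ i ∈ Finset.range (K * H), f (i / H) (i % H) =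
      ∑ k ∈ Finset.range K, ∑ h ∈ Finset.range H, f k h := by
  induction K with
  | zero => simp
  | succ K ih =>
    rw [Nat.succ_mul, Finset.sum_range_add, ih, Finset.sum_range_succ]
    congr 1
    refine Finset.sum_congr rfl fun j hj => ?_
    have hj := Finset.mem_range.1 hj
    rw [mul_comm K H, Nat.mul_add_div hH, Nat.div_eq_of_lt hj, add_zero, Nat.mul_add_mod,
      Nat.mod_eq_of_lt hj]

/-- The Azuma-Hoeffding bound for the martingale part of the regret. -/
theorem Interaction.measure_noise_le [IsProbabilityMeasure μ] (I : Interaction M H K μ)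
    (hψ : Measurable fun x : S × A × W => ψ x.1 x.2.1 x.2.2) (β : ℝ) (hH : 0 < H) (hK : 0 < K)
    {l : ℝ} (hl : 0 < l) :
    μ {ω | 2 * H * √(K * H * l) < - ∑ k ∈ Finset.range K, ∑ h ∈ Finset.range H,
      I.noise ψ β k h ω} ≤ ENNReal.ofReal (Real.exp (-l)) := by
  have hH' : (0 : ℝ) < H := by exact_mod_cast hH
  have hK' : (0 : ℝ) < K := by exact_mod_cast hK
  set q := √(K * H * l) with hq
  have hq0 : 0 < q := Real.sqrt_pos.2 (by positivity)
  have hq2 : q ^ 2 = K * H * l := Real.sq_sqrt (by positivity)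
  -- At the threshold `2Hq` the linear term is `γ · 2Hq = 2l` and the compensator totals `l / 2`,
  -- which leaves `3l / 2 ≥ l`. The gap has range `[-H, H]`, since it may be negative off the good
  -- event; hence the length `2γH`.
  set γ := q / (K * H * H) with hγ
  have hγ0 : 0 < γ := by positivity
  let X : ℕ → Ω → ℝ := fun i ω =>
    increment M (I.log ω) (i / H) (i % H) (fun s => -γ * I.gap ψ β (i / H) (i % H + 1) ω s) -
      (2 * γ * H) ^ 2 / 8
  have hXeq : ∀ i ω, X i ω = -γ * I.noise ψ β (i / H) (i % H) ω - (2 * γ * H) ^ 2 / 8 :=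
    fun i ω => by
      simp only [X, Interaction.noise, increment, integral_const_mul]
      ring
  have hsum : ∀ ω, ∑ i ∈ Finset.range (K * H), X i ω =
      γ * (-∑ k ∈ Finset.range K, ∑ h ∈ Finset.range H, I.noise ψ β k h ω) -
        K * H * ((2 * γ * H) ^ 2 / 8) := fun ω => by
    simp only [hXeq]
    rw [Finset.sum_sub_distrib, ← Finset.mul_sum,
      sum_range_mul_eq (fun k h => I.noise ψ β k h ω) hH]
    simp
  have hg : ∀ i < K * H, Measurable[(I.filt (clock H (i / H) (i % H))).prod
      (inferInstance : MeasurableSpace S)]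
      fun x : Ω × S => -γ * I.gap ψ β (i / H) (i % H + 1) x.1 x.2 := fun i hi =>
    letI := I.filt (clock H (i / H) (i % H))
    (I.measurable_gap hψ β (Nat.div_lt_of_lt_mul (by rwa [mul_comm] at hi)) _ _).const_mul (-γ)
  have hmeas : ∀ i < K * H, Measurable[I.filt (clock H (i / H) (i % H + 1))] (X i) := fun i hi =>
    (I.measurable_increment (Nat.div_lt_of_lt_mul (by rwa [mul_comm] at hi)) (Nat.mod_lt i hH)
      (hg i hi)).sub measurable_const
  -- Pairs (episode, step) are flattened to `i = kH + h`. An increment is known at the next clock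
  -- time, which never exceeds the time of a later pair.
  have hclock : ∀ i j, j < i → clock H (j / H) (j % H + 1) ≤ clock H (i / H) (i % H) := by
    intro i j hji
    have hj := Nat.mod_lt j hH
    rcases (Nat.div_le_div_right (c := H) hji.le).eq_or_lt with h | h
    · have h1 := Nat.div_add_mod i H
      have h2 := Nat.div_add_mod j H
      rw [h] at h2 ⊢
      unfold clock
      omega
    · exact clock_mono h (by omega)
  have htail := measure_sum_ge_le_exp_neg (μ := μ) (fun i => I.filt (clock H (i / H) (i % H)))
    (K * H) X
    (fun i hi j hj => (hmeas j (hj.trans hi)).mono (I.filt.mono (hclock i j hj)) le_rfl)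
    (fun i hi => (hmeas i hi).mono (I.filt.le _) le_rfl) (fun i hi F hF => by
      refine I.lintegral_exp_increment_le (Nat.div_lt_of_lt_mul (by rwa [mul_comm] at hi))
        (Nat.mod_lt i hH) (hg i hi) (a := fun _ => -γ * H) (ℓ := fun _ => 2 * γ * H)
        measurable_const (fun ω s => ?_) hF
      obtain ⟨h1, h2⟩ := Vfun_mem_Icc (r := M.r) (H := H) (ψ := ψ) (β := β) (lam := 1)
        (h := i % H + 1) (k := planUsed H ψ 1 (I.log ω) (i / H)) (I.log ω) s (I.ctx (i / H) ω)
      obtain ⟨h3, h4⟩ := M.value_mem_Icc H (I.policy (i / H) ω) (i % H + 1) s (I.ctx (i / H) ω)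
      unfold Interaction.gap valueGap
      constructor <;> nlinarith) l
  refine (measure_mono fun ω hω => ?_).trans htail
  simp only [Set.mem_ofPred_eq] at hω ⊢
  rw [hsum]
  have h1 : γ * (2 * H * q) = 2 * l := by
    rw [hγ, show q / (K * H * H) * (2 * H * q) = 2 * q ^ 2 / (K * H) by field_simp, hq2]
    field_simp
  have h2 : K * H * ((2 * γ * H) ^ 2 / 8) = l / 2 := by
    rw [hγ, show (K : ℝ) * H * ((2 * (q / (K * H * H)) * H) ^ 2 / 8) = q ^ 2 / (K * H) / 2 by
      field_simp; ring, hq2]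
    field_simp
  have h3 := mul_lt_mul_of_pos_left hω hγ0
  linarith

end Regret

/-! ### Choice of constants. -/

section Numerics

/-- The mesh of the net is fine enough. -/
theorem net_slack_le {d H K X β s : ℝ} (hd : 1 ≤ d) (hH : 1 ≤ H) (hK : 1 ≤ K) (hX : 2 ≤ X)
    (hdKH : d * K * H ≤ X) (hβ0 : 0 ≤ β) (hβ : β ≤ X ^ 6) (hs : s = (X ^ 14)⁻¹) :
    K * (d * s ^ 2 * H + 2 * X ^ 2 * (d * s ^ 2 + β * (d * s)) +
      H ^ 2 * (d * s ^ 2) * (2 * X ^ 2 + d * s ^ 2) / 8) ≤ 1 := by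
  have hX1 : 1 ≤ X := by linarith
  have hs0 : 0 < s := by rw [hs]; positivity
  have hs14 : s * X ^ 14 = 1 := by rw [hs]; field_simp
  have hpow : ∀ {m n : ℕ}, m ≤ n → X ^ m ≤ X ^ n := fun h => pow_le_pow_right₀ hX1 h
  have hs1 : s ≤ 1 := by
    rw [← hs14]
    exact le_mul_of_one_le_right hs0.le (one_le_pow₀ hX1)
  have hss : s ^ 2 ≤ s := by nlinarith
  -- The four error terms are each at most `X¹² s = X⁻² ≤ 1/4`; the largest estimate, `X¹⁰ s`, comes
  -- from the bonus.
  have h12 : X ^ 12 * s ≤ 1 / 4 := by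
    have : (2 : ℝ) ^ 2 ≤ X ^ 2 := by gcongr
    have h : X ^ 12 * s * 2 ^ 2 ≤ X ^ 12 * s * X ^ 2 := by gcongr
    have e : X ^ 12 * s * X ^ 2 = 1 := by rw [← hs14]; ring
    linarith
  have hKd : K * d ≤ X := by nlinarith [mul_nonneg (by linarith : (0 : ℝ) ≤ d) (by linarith : 0 ≤ K)]
  have hdX : d ≤ X := by nlinarith
  have hHX : H ≤ X := by
    have : 1 ≤ d * K := by nlinarith
    nlinarith
  have hds : d * s ^ 2 ≤ X := by nlinarith
  have t1 : K * (d * s ^ 2 * H) ≤ 1 / 4 := by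
    calc K * (d * s ^ 2 * H) = (d * K * H) * s ^ 2 := by ring
      _ ≤ X ^ 1 * s := by rw [pow_one]; gcongr
      _ ≤ X ^ 12 * s := mul_le_mul_of_nonneg_right (hpow (by norm_num)) hs0.le
      _ ≤ _ := h12
  have t2 : K * (2 * X ^ 2 * (d * s ^ 2)) ≤ 1 / 4 := by
    calc K * (2 * X ^ 2 * (d * s ^ 2)) = (K * d) * (2 * X ^ 2) * s ^ 2 := by ring
      _ ≤ X * (X * X ^ 2) * s := by gcongr
      _ = X ^ 4 * s := by ring
      _ ≤ X ^ 12 * s := mul_le_mul_of_nonneg_right (hpow (by norm_num)) hs0.le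
      _ ≤ _ := h12
  have t3 : K * (2 * X ^ 2 * (β * (d * s))) ≤ 1 / 4 := by
    calc K * (2 * X ^ 2 * (β * (d * s))) = (K * d) * (2 * X ^ 2) * β * s := by ring
      _ ≤ X * (X * X ^ 2) * X ^ 6 * s := by gcongr
      _ = X ^ 10 * s := by ring
      _ ≤ X ^ 12 * s := mul_le_mul_of_nonneg_right (hpow (by norm_num)) hs0.le
      _ ≤ _ := h12
  have t4 : K * (H ^ 2 * (d * s ^ 2) * (2 * X ^ 2 + d * s ^ 2) / 8) ≤ 1 / 4 := by
    calc K * (H ^ 2 * (d * s ^ 2) * (2 * X ^ 2 + d * s ^ 2) / 8)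
        = (d * K * H) * H * s ^ 2 * ((2 * X ^ 2 + d * s ^ 2) / 8) := by ring
      _ ≤ X * X * s * X ^ 2 := by
        gcongr
        nlinarith
      _ = X ^ 4 * s := by ring
      _ ≤ X ^ 12 * s := mul_le_mul_of_nonneg_right (hpow (by norm_num)) hs0.le
      _ ≤ _ := h12
  have e : K * (d * s ^ 2 * H + 2 * X ^ 2 * (d * s ^ 2 + β * (d * s)) +
      H ^ 2 * (d * s ^ 2) * (2 * X ^ 2 + d * s ^ 2) / 8) =
      K * (d * s ^ 2 * H) + K * (2 * X ^ 2 * (d * s ^ 2)) + K * (2 * X ^ 2 * (β * (d * s))) +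
      K * (H ^ 2 * (d * s ^ 2) * (2 * X ^ 2 + d * s ^ 2) / 8) := by ring
  rw [e]
  linarith

theorem net_card_le {d H K : ℕ} {X : ℝ} (hd : 0 < d) (hX : 2 ≤ X) (hHK : (H : ℝ) * K ≤ X) :
    ((2 * (⌈X ^ 30⌉₊ + 1 : ℕ) + 1 : ℝ)) ^ (2 * d + d ^ 2) * (H * K) *
      Real.exp (-(98 * (d : ℝ) ^ 2 * Real.log X)) ≤ X⁻¹ := by
  have hX1 : 1 ≤ X := by linarith
  have hX0 : 0 < X := by linarith
  have h1 : (2 * (⌈X ^ 30⌉₊ + 1 : ℕ) + 1 : ℝ) ≤ X ^ 32 := by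
    have h := (Nat.ceil_lt_add_one (by positivity : 0 ≤ X ^ 30)).le
    have h2 : (2 : ℝ) ^ 30 ≤ X ^ 30 := by gcongr
    have h3 : X ^ 30 * 2 ^ 2 ≤ X ^ 30 * X ^ 2 := by gcongr
    have h4 : X ^ 32 = X ^ 30 * X ^ 2 := by ring
    push_cast
    rw [h4]
    norm_num at h2 h3
    linarith
  have h2 : Real.exp (-(98 * (d : ℝ) ^ 2 * Real.log X)) = (X ^ (98 * d ^ 2))⁻¹ := by
    rw [Real.exp_neg, show (98 * (d : ℝ) ^ 2 * Real.log X) = Real.log (X ^ (98 * d ^ 2)) by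
      rw [Real.log_pow]; push_cast; ring, Real.exp_log (by positivity)]
  -- These give `32 (2d + d²) + 1 ≤ 98 d² - 1`, the reason for the constant 98 in the level.
  have hdd : d ≤ d ^ 2 := Nat.le_self_pow two_ne_zero d
  have hd2 : 1 ≤ d ^ 2 := Nat.one_le_pow _ _ hd
  rw [h2, ← div_eq_mul_inv, div_le_iff₀ (by positivity)]
  calc (2 * (⌈X ^ 30⌉₊ + 1 : ℕ) + 1 : ℝ) ^ (2 * d + d ^ 2) * (H * K)
      ≤ (X ^ 32) ^ (2 * d + d ^ 2) * X := by gcongr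
    _ = X ^ (32 * (2 * d + d ^ 2) + 1) := by rw [← pow_mul, ← pow_succ]
    _ ≤ X ^ (98 * d ^ 2 - 1) := pow_le_pow_right₀ hX1 (by omega)
    _ = X⁻¹ * X ^ (98 * d ^ 2) := by
      obtain ⟨m, hm⟩ : ∃ m, 98 * d ^ 2 = m + 1 := ⟨98 * d ^ 2 - 1, by omega⟩
      rw [hm, Nat.add_sub_cancel, pow_succ]
      field_simp

/-- Bias and noise each contribute at most `8 d H √l`, which is the source of the constant 16 in
`β`. -/
theorem confidence_radius_le {d H l : ℝ} (hd : 1 ≤ d) (hH : 1 ≤ H) (hl : 1 / 2 ≤ l) :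
    H * √d + H * √((98 * d ^ 2 * l + 1) / 2) ≤ 16 * d * H * √l := by
  have hl2 : 1 / 2 ≤ √l := by
    rw [Real.le_sqrt (by norm_num) (by linarith)]
    linarith
  have h1 : √d ≤ d := by
    rw [Real.sqrt_le_left (by linarith)]
    nlinarith
  have h2 : √((98 * d ^ 2 * l + 1) / 2) ≤ 8 * d * √l := by
    refine Real.sqrt_le_iff.2 ⟨by positivity, ?_⟩
    rw [mul_pow, Real.sq_sqrt (by linarith)]
    have : 1 ≤ d ^ 2 := one_le_pow₀ hd
    nlinarith
  have h3 : d ≤ 8 * d * √l := by nlinarith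
  have h4 : √d + √((98 * d ^ 2 * l + 1) / 2) ≤ 16 * d * √l := by linarith
  calc H * √d + H * √((98 * d ^ 2 * l + 1) / 2) = H * (√d + √((98 * d ^ 2 * l + 1) / 2)) := by ring
    _ ≤ H * (16 * d * √l) := by gcongr
    _ = _ := by ring

theorem regret_bound_le {d H K l : ℝ} (hd : 1 ≤ d) (hH : 1 ≤ H) (hK : 1 ≤ K) (hl : 1 / 2 ≤ l)
    (hlog : Real.log K ≤ l) :
    2 * H * √(K * H * l) + 4 * H * (16 * d * H * √l) * √(2 * d * K * Real.log K) ≤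
      132 * √(d ^ 3 * H ^ 3 * (K * H)) * l := by
  have hl0 : 0 ≤ l := by linarith
  have hlK : 0 ≤ Real.log K := Real.log_nonneg hK
  set a := √(d ^ 3 * H ^ 3 * (K * H)) with ha
  have ha0 : 0 ≤ a := Real.sqrt_nonneg _
  have ha2 : a ^ 2 = d ^ 3 * H ^ 3 * (K * H) := Real.sq_sqrt (by positivity)
  have h1 : H * √(K * H * l) ≤ 2 * (a * l) := by
    refine (abs_le_of_sq_le_sq' ?_ (by positivity)).2
    rw [mul_pow, Real.sq_sqrt (by positivity), mul_pow, mul_pow, ha2]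
    have h3 : 1 ≤ d ^ 3 * H := one_le_mul_of_one_le_of_one_le (one_le_pow₀ hd) hH
    have h4 : l ≤ 2 ^ 2 * l ^ 2 := by nlinarith
    calc H ^ 2 * (K * H * l) = 1 * (H ^ 2 * (K * H)) * l := by ring
      _ ≤ (d ^ 3 * H) * (H ^ 2 * (K * H)) * (2 ^ 2 * l ^ 2) := by gcongr
      _ = _ := by ring
  have h2 : d * H ^ 2 * √l * √(2 * d * K * Real.log K) ≤ 2 * (a * l) := by
    refine (abs_le_of_sq_le_sq' ?_ (by positivity)).2
    rw [mul_pow, mul_pow, mul_pow, Real.sq_sqrt hl0, Real.sq_sqrt (by positivity), mul_pow,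
      mul_pow, ha2]
    calc d ^ 2 * (H ^ 2) ^ 2 * l * (2 * d * K * Real.log K)
        ≤ d ^ 2 * (H ^ 2) ^ 2 * l * (4 * d * K * l) := by
          gcongr
          norm_num
      _ = _ := by ring
  -- The constant is `132 = 2 · 2 + 64 · 2`, with `64 = 4 · 16`.
  nlinarith

end Numerics

/-! ### Assembling the regret bound. -/

section SingleEpisode

variable {S A W Ω : Type*} [MeasurableSpace S] [MeasurableSpace A] [MeasurableSpace W]
  [Nonempty A] {mΩ : MeasurableSpace Ω} {μ : Measure Ω} {H : ℕ} {M : ContextualMDP S A W}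

theorem Interaction.regret_le_horizon (I : Interaction M H 1 μ) (ω : Ω) : I.regret ω ≤ H := by
  rw [Interaction.regret, Finset.sum_range_one]
  have h1 := M.optValue_le H (I.ctx 0 ω) (h := 0) (s := I.state 0 0 ω)
    fun p => M.value_le_horizon H p (I.ctx 0 ω) 0 (I.state 0 0 ω)
  have h2 := M.value_nonneg H (I.policy 0 ω) (I.ctx 0 ω) 0 (I.state 0 0 ω)
  linarith

end SingleEpisode

section Main

open scoped ENNReal

variable {S A W Ω : Type*} [MeasurableSpace S] [MeasurableSpace A] [MeasurableSpace W]
  [Fintype A] [Nonempty A] {mΩ : MeasurableSpace Ω} {μ : Measure Ω} [IsProbabilityMeasure μ]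
  {d H K : ℕ} {M : ContextualMDP S A W} {ψ : S → A → W → EuclideanSpace ℝ (Fin d)}
  {η : ℕ → EuclideanSpace ℝ (Fin d)}

theorem Interaction.measure_not_accurate_le (I : Interaction M H K μ) (hd : 0 < d) (hH : 0 < H)
    (hK : 0 < K) (hψ : Measurable fun x : S × A × W => ψ x.1 x.2.1 x.2.2)
    (hC : Completeness M H ψ η) (hB : Boundedness H ψ η) {X : ℝ} (hX : 2 * (d * (K * H)) ≤ X) :
    μ {ω | ¬ ∀ k < K, Accurate M H ψ (16 * d * H * √(Real.log X)) (I.log ω) k} ≤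
      ENNReal.ofReal X⁻¹ := by
  have hd' : (1 : ℝ) ≤ d := by exact_mod_cast hd
  have hH' : (1 : ℝ) ≤ H := by exact_mod_cast hH
  have hK' : (1 : ℝ) ≤ K := by exact_mod_cast hK
  have hKH : (1 : ℝ) ≤ K * H := one_le_mul_of_one_le_of_one_le hK' hH'
  have hdKH : (1 : ℝ) ≤ d * (K * H) := one_le_mul_of_one_le_of_one_le hd' hKH
  have hX2 : 2 ≤ X := by linarith
  have hX1 : 1 ≤ X := by linarith
  have hX0 : 0 < X := by linarith
  have hl : 1 / 2 ≤ Real.log X := by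
    have := Real.log_two_gt_d9
    have := Real.log_le_log two_pos hX2
    linarith
  set β := 16 * d * H * √(Real.log X) with hβ
  have hβ0 : 0 ≤ β := by positivity
  have hβX : β ≤ X ^ 6 := by
    have h1 : √(Real.log X) ≤ X := by
      rw [Real.sqrt_le_left hX0.le]
      have := Real.log_le_sub_one_of_pos hX0
      nlinarith
    have h2 : (d : ℝ) * H ≤ X := by nlinarith
    have h3 : (2 : ℝ) ^ 4 ≤ X ^ 4 := by gcongr
    calc β = 2 ^ 4 * (d * H) * √(Real.log X) := by rw [hβ]; ring
      _ ≤ X ^ 4 * X * X := by gcongr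
      _ = X ^ 6 := by ring
  -- The mesh is `s² = X⁻²⁸`, so that its root is `s`. With parameter radius `X²` the grid needs
  -- about `X³⁰` points per coordinate.
  set s : ℝ := (X ^ 14)⁻¹ with hs
  have hs0 : 0 < s := by positivity
  have hslack := net_slack_le hd' hH' hK' hX2 (by nlinarith) hβ0 hβX hs
  have hN : X ^ 2 / s ^ 2 + 1 ≤ ((⌈X ^ 30⌉₊ + 1 : ℕ) : ℝ) := by
    have e : X ^ 2 / s ^ 2 = X ^ 30 := by rw [hs]; field_simp
    rw [e]
    push_cast
    linarith [Nat.le_ceil (X ^ 30)]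
  have hle := I.measure_not_netGood_le hψ β (s ^ 2) (⌈X ^ 30⌉₊ + 1)
    (98 * (d : ℝ) ^ 2 * Real.log X)
  refine (measure_mono fun ω hω => ?_).trans
    (hle.trans (ENNReal.ofReal_le_ofReal (net_card_le hd hX2 (by nlinarith))))
  simp only [Set.mem_ofPred_eq] at hω ⊢
  contrapose! hω
  intro k hk h hh st a w
  refine hω.abs_backup_sub_le hψ hC hB hβ0 (by positivity) hN ?_ (one_le_pow₀ hX1) ?_ ?_ ?_
    hh hk st a w
  · rwa [Real.sqrt_sq hs0.le]
  · nlinarith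
  · have h1 : √(d : ℝ) ≤ d := by
      rw [Real.sqrt_le_left (by linarith)]
      nlinarith
    nlinarith
  · exact confidence_radius_le hd' hH' hl

theorem Interaction.regret_bound (I : Interaction M H K μ) (hd : 0 < d) (hH : 0 < H)
    (hK : 0 < K) (hψ : Measurable fun x : S × A × W => ψ x.1 x.2.1 x.2.2)
    (hC : Completeness M H ψ η) (hB : Boundedness H ψ η) {δ β X : ℝ} (hδ : 0 < δ) (hδ' : δ < 1 / 2)
    (hX : X = d * (K * H) / δ) (hβ : β = 16 * d * H * √(Real.log X)) (hrun : I.RunsLSVI ψ 1 β) :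
    ENNReal.ofReal (1 - 2 * δ) ≤ μ {ω | I.regret ω ≤ 2 * H * √(K * H * Real.log X) +
      4 * H * β * √(2 * d * K * Real.log K)} := by
  have hd' : (1 : ℝ) ≤ d := by exact_mod_cast hd
  have hH' : (1 : ℝ) ≤ H := by exact_mod_cast hH
  have hK' : (1 : ℝ) ≤ K := by exact_mod_cast hK
  have hKH : (1 : ℝ) ≤ K * H := one_le_mul_of_one_le_of_one_le hK' hH'
  have hdKH : (1 : ℝ) ≤ d * (K * H) := one_le_mul_of_one_le_of_one_le hd' hKH
  have hX2 : 2 * (d * (K * H)) ≤ X := by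
    rw [hX, le_div_iff₀ hδ]
    nlinarith
  have hX0 : 0 < X := by linarith
  have hl : 1 / 2 ≤ Real.log X := by
    have := Real.log_two_gt_d9
    have := Real.log_le_log two_pos (by linarith : 2 ≤ X)
    linarith
  have hβ0 : 0 ≤ β := by rw [hβ]; positivity
  have hXδ : X⁻¹ ≤ δ := by
    rw [hX, inv_div]
    exact div_le_self hδ.le hdKH
  rcases (show K = 1 ∨ 2 ≤ K by omega) with rfl | hK2
  -- For a single episode `log K = 0` removes the bonus term, but the regret is at most `H`, which
  -- the first term already covers.
  · have : {ω | I.regret ω ≤ 2 * H * √((1 : ℕ) * H * Real.log X) +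
        4 * H * β * √(2 * d * (1 : ℕ) * Real.log (1 : ℕ))} = Set.univ := by
      refine Set.eq_univ_of_forall fun ω => (I.regret_le_horizon ω).trans ?_
      have h1 : 1 / 2 ≤ √((1 : ℕ) * H * Real.log X) := by
        rw [Real.le_sqrt (by norm_num) (by positivity)]
        push_cast
        nlinarith
      have h2 : 0 ≤ 4 * H * β * √(2 * d * (1 : ℕ) * Real.log (1 : ℕ)) := by positivity
      have h3 := mul_le_mul_of_nonneg_left h1 (show (0 : ℝ) ≤ 2 * H by positivity)
      simp only [Nat.cast_one] at h2 h3 ⊢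
      linarith
    rw [this, measure_univ, ENNReal.ofReal_le_one]
    linarith
  set G := {ω | I.regret ω ≤ 2 * H * √(K * H * Real.log X) +
      4 * H * β * √(2 * d * K * Real.log K)} with hG
  have h1 := I.measure_not_accurate_le hd hH hK hψ hC hB hX2
  rw [← hβ] at h1
  have h2 := I.measure_noise_le hψ β hH hK (show 0 < Real.log X by linarith)
  rw [Real.exp_neg, Real.exp_log hX0] at h2
  have hcompl : Gᶜ ⊆ {ω | ¬ ∀ k < K, Accurate M H ψ β (I.log ω) k} ∪
      {ω | 2 * H * √(K * H * Real.log X) < - ∑ k ∈ Finset.range K, ∑ h ∈ Finset.range H,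
        I.noise ψ β k h ω} := by
    intro ω hω
    by_contra hcon
    simp only [Set.mem_union, Set.mem_ofPred_eq, not_or, not_not, not_lt] at hcon
    obtain ⟨hacc, hnoise⟩ := hcon
    refine hω ?_
    have h3 := I.regret_le hrun hβ0 hψ hacc
    have h4 : ∑ h ∈ Finset.range H, ∑ k ∈ Finset.range K,
        wnorm (gram ψ 1 (I.log ω) h (planUsed H ψ 1 (I.log ω) k))⁻¹ ((I.log ω).feature ψ h k) ≤
        H * (2 * √(2 * d * K * Real.log K)) := by
      refine (Finset.sum_le_sum fun h hh => sum_wnorm_planUsed_le (I.log ω) h hB.feature hd hK2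
        (Finset.mem_range.1 hh)).trans ?_
      simp
    have h5 := mul_le_mul_of_nonneg_left h4 (show 0 ≤ 2 * β by positivity)
    simp only [hG, Set.mem_ofPred_eq]
    have e : 2 * β * (H * (2 * √(2 * d * K * Real.log K))) =
      4 * H * β * √(2 * d * K * Real.log K) := by ring
    linarith
  -- Each of the two failure events has probability at most `X⁻¹ = δ / (dT) ≤ δ`.
  have h3 : μ Gᶜ ≤ ENNReal.ofReal (2 * δ) := by
    refine (measure_mono hcompl).trans ((measure_union_le _ _).trans ((add_le_add h1 h2).trans ?_))
    rw [← ENNReal.ofReal_add (by positivity) (by positivity)]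
    exact ENNReal.ofReal_le_ofReal (by linarith)
  -- Subadditivity replaces the complement rule: the optimal value is a supremum over possibly
  -- uncountably many policies, so `G` is not known to be measurable.
  have h4 : 1 ≤ μ G + μ Gᶜ := by
    rw [← measure_univ (μ := μ), ← Set.union_compl_self G]
    exact measure_union_le _ _
  rw [ENNReal.ofReal_sub _ (by positivity), ENNReal.ofReal_one]
  exact tsub_le_iff_right.2 (h4.trans (add_le_add_right h3 _))

end Main

end LifelongRL

end

theorem mainTheorem5 :
    ∃ c : ℝ, 0 < c ∧ ∃ C : ℝ, 0 < C ∧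
    ∀ (S A W Ω : Type*) [MeasurableSpace S] [MeasurableSpace A] [MeasurableSpace W]
      [MeasurableSpace Ω] [Fintype A] [Nonempty A] [DiscreteMeasurableSpace A]
      (μ : MeasureTheory.Measure Ω) [MeasureTheory.IsProbabilityMeasure μ]
      (M : LifelongRL.ContextualMDP S A W) (d H K : ℕ)
      (ψ : S → A → W → EuclideanSpace ℝ (Fin d)) (η : ℕ → EuclideanSpace ℝ (Fin d)),
      0 < d → 0 < H → 0 < K →
      Measurable (fun x : S × A × W => ψ x.1 x.2.1 x.2.2) →
      LifelongRL.Completeness M H ψ η →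
      LifelongRL.Boundedness H ψ η →
      (∀ (lam β : ℝ) (I : LifelongRL.Interaction M H K μ), 0 < lam →
        I.RunsLSVI ψ lam β →
        ∀ ω, (LifelongRL.planningCalls H ψ lam (I.log ω) K : ℝ) ≤
          d * H * Real.log (1 + K / (d * lam))) ∧
      (∀ (T δ β : ℝ), T = K * H → 0 < δ → δ < 1 / 2 →
        β = c * d * H * Real.sqrt (Real.log (d * T / δ)) →
        (∀ I : LifelongRL.Interaction M H K μ, I.RunsLSVI ψ 1 β →
          ENNReal.ofReal (1 - 2 * δ) ≤
            μ {ω | I.regret ω ≤ 2 * H * Real.sqrt (T * Real.log (d * T / δ)) +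
              4 * H * β * Real.sqrt (2 * d * K * Real.log K)}) ∧
        2 * H * Real.sqrt (T * Real.log (d * T / δ)) +
            4 * H * β * Real.sqrt (2 * d * K * Real.log K) ≤
          C * Real.sqrt ((d : ℝ) ^ 3 * (H : ℝ) ^ 3 * T) * Real.log (d * T / δ)) := by
  -- The constants are those of `confidence_radius_le` and `regret_bound_le`.
  refine ⟨16, by norm_num, 132, by norm_num, ?_⟩
  intro S A W Ω _ _ _ _ _ _ _ μ _ M d H K ψ η hd hH hK hψ hC hB
  refine ⟨fun lam β I hlam _ ω => LifelongRL.planningCalls_le (I.log ω) hB.feature hd hlam H K, ?_⟩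
  rintro T δ β rfl hδ hδ' hβ
  refine ⟨fun I hrun => I.regret_bound hd hH hK hψ hC hB hδ hδ' rfl hβ hrun, ?_⟩
  have hd' : (1 : ℝ) ≤ d := by exact_mod_cast hd
  have hH' : (1 : ℝ) ≤ H := by exact_mod_cast hH
  have hK' : (1 : ℝ) ≤ K := by exact_mod_cast hK
  have hdH : (1 : ℝ) ≤ d * H := one_le_mul_of_one_le_of_one_le hd' hH'
  have hX : 2 * K ≤ (d : ℝ) * (K * H) / δ := by
    rw [le_div_iff₀ hδ]
    nlinarith
  have hl : 1 / 2 ≤ Real.log (d * (K * H) / δ) := by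
    have := Real.log_two_gt_d9
    have := Real.log_le_log two_pos (by linarith : 2 ≤ (d : ℝ) * (K * H) / δ)
    linarith
  rw [hβ]
  exact LifelongRL.regret_bound_le hd' hH' hK' hl (Real.log_le_log (by linarith) (by linarith))
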